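/- **Conventions.** For a cardinal $\chi$, $\mathcal H_\chi$ is the set of all sets whose transitive closure has size $<\chi$, and $\mathcal M_\chi$ is the set of elementary submodels $M$ of $(\mathcal H_\chi,\in)$ such that $|M|=\aleph_1$ and $[M]^{\aleph_0}\cap M$ is cofinal in $([M]^{\aleph_0},\subseteq)$. For a subalgebra $A$ of a Boolean algebra $B$ and $b\in B$, let $A\restriction b=\{a\in A: a\le b\}$. Write $A\le_{sep}B$ if for every $b\in B$ and every uncountable $T\subseteq A\restriction b$ there is $a\in A\restriction b$ such that $\{c\in T:c\le a\}$ is uncountable; write $A\le_\sigma B$ if for every $b\in B$ the set $A\restriction b$ has a countable cofinal subset. For a Boolean algebra $A$: * $\operatorname{SEP}(A)$ means that for all sufficiently large regular $\chi$, for every $X\subseteq\mathcal H_\chi$ with $|X|=\aleph_1$ there is $M\in\mathcal M_\chi$ with $X\subseteq M$ and $A\cap M\le_{sep}A$; * $\operatorname{IDP}(A)$ means that for all sufficiently large regular $\chi$ and all $M\in\mathcal M_\chi$ with $A\in M$ (that is, the structure $(A,\vee,\wedge,-,0,1)$ is an element of $M$), $A\cap M\le_\sigma A$. (Both $A\cap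 M\le_{sep}A$ and $A\cap M\le_\sigma A$ include that $A\cap M$ is a subalgebra of $A$.) Let $E=\{\alpha<\omega_2:\operatorname{cf}(\alpha)=\aleph_1\}$. A *ladder system* $\delta$ assigns to every $\alpha\in E$ a strictly increasing sequence $(\delta^\alpha_\beta)_{\beta<\omega_1}$ of successor ordinals that is cofinal in $\alpha$. For $S\subseteq E$ and a ladder system $\delta$, the Boolean algebra $A^S$ is $\bigcup_{\alpha<\omega_2}A^S_\alpha$, where the increasing chain of subalgebras $A^S_\alpha$ and elements $x_\alpha$ $(\alpha<\omega_2)$ satisfy: * $A^S_0=\{0,1\}$ with $0\ne1$, and $A^S_\alpha=\bigcup_{\beta<\alpha}A^S_\beta$ for limit $\alpha$; * $A^S_{\alpha+1}=A^S_\alpha(x_\alpha)$ is generated by $A^S_\alpha\cup\{x_\alpha\}$; * if $\alpha\notin S$, then $x_\alpha$ is independent over $A^S_\alpha$, i.e. $a\wedge x_\alpha\ne0\ne a\wedge -x_\alpha$ for all nonzero $a\in A^S_\alpha$; * if $\alpha\in S$, then $x_\alpha\notin A^S_\alpha$, $A^S_\alpha\restriction x_\alpha$ is the ideal of $A^S_\alpha$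 generated by $\{x_{\delta^\alpha_\beta}:\beta<\omega_1\}$, and $A^S_\alpha\restriction -x_\alpha=\{0\}$. **Theorem 6.4** (ZFC). There is a Boolean algebra $A$ with $\operatorname{SEP}(A)$ but not $\operatorname{IDP}(A)$. More precisely, there are disjoint stationary subsets $S_0,S_1$ of $\omega_2$ with $S_0\cup S_1=E$, and there are ladder systems; and for any such $S_0,S_1$ and any ladder system, the algebra $A^{S_1}$ exists, and every such algebra $A=A^{S_1}$ satisfies $\operatorname{SEP}(A)$ but not $\operatorname{IDP}(A)$. -/

import Mathlib

open Cardinal Ordinal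

universe u

/-! ### The structure `(H_χ, ∈)` and its good elementary submodels -/

/-- The relation symbols of the language of set theory: a single binary symbol. -/
inductive MemRel : ℕ → Type
  | mem : MemRel 2

/-- The first-order language of set theory. -/
def setLang : FirstOrder.Language :=
  ⟨fun _ => Empty, MemRel⟩

/-- `H_χ`: the sets whose transitive closure has cardinality less than `χ`, that is, the sets
included in a transitive set of cardinality less than `χ`. -/
def hereditarySets (χ : Cardinal.{u}) : Set ZFSet.{u} :=
  {x | ∃ t : ZFSet.{u}, t.IsTransitive ∧ x ⊆ t ∧ t.card < χ}

/-- `H_χ` as a structure for the language of set theory. -/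
instance hereditarySetsStructure (χ : Cardinal.{u}) : setLang.Structure (hereditarySets χ) where
  funMap := fun f => nomatch f
  RelMap := fun r =>
    match r with
    | MemRel.mem => fun v => (v 0 : ZFSet.{u}) ∈ (v 1 : ZFSet.{u})

/-- `M` is the underlying set of an elementary submodel of `(H_χ, ∈)`. -/
def IsElementarySubmodel (χ : Cardinal.{u}) (M : Set ZFSet.{u}) : Prop :=
  ∃ N : setLang.ElementarySubstructure (hereditarySets χ),
    M = Subtype.val '' (N : Set (hereditarySets χ))

/-- The set of elementary submodels `M` of `H_χ` such that `|M| = ℵ₁` and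
`[M]^ℵ₀ ∩ M` is cofinal in `[M]^ℵ₀`. -/
def goodSubmodels (χ : Cardinal.{u}) : Set (Set ZFSet.{u}) :=
  {M | IsElementarySubmodel χ M ∧ #M = ℵ₁ ∧
    ∀ X : Set ZFSet.{u}, X ⊆ M → #X = ℵ₀ →
      ∃ y : ZFSet.{u}, y ∈ M ∧ (y : Set ZFSet.{u}) ⊆ M ∧ #(y : Set ZFSet.{u}) = ℵ₀ ∧
        X ⊆ (y : Set ZFSet.{u})}

/-! ### The embeddings `≤_sep` and `≤_σ` -/

/-- `A ≤_sep B`: for every `b ∈ B`, every uncountable subset `T` of `A ↾ b = {a ∈ A | a ≤ b}` has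
uncountably many elements below a single element of `A ↾ b`. -/
def SepEmbedded {B : Type*} [BooleanAlgebra B] (A : BooleanSubalgebra B) : Prop :=
  ∀ (b : B) (T : Set B), T ⊆ {a | a ∈ A ∧ a ≤ b} → ¬ T.Countable →
    ∃ a, a ∈ A ∧ a ≤ b ∧ ¬ {c | c ∈ T ∧ c ≤ a}.Countable

/-- `A ≤_σ B`: for every `b ∈ B`, `A ↾ b = {a ∈ A | a ≤ b}` has a countable cofinal subset. -/
def SigmaEmbedded {B : Type*} [BooleanAlgebra B] (A : BooleanSubalgebra B) : Prop :=
  ∀ b : B, ∃ C : Set B, C.Countable ∧ C ⊆ {a | a ∈ A ∧ a ≤ b} ∧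
    ∀ a ∈ A, a ≤ b → ∃ c ∈ C, a ≤ c

/-! ### Boolean algebras as sets, SEP and IDP -/

/-- A Boolean algebra whose underlying set is a set of the universe `ZFSet`. -/
structure SetBooleanAlgebra where
  carrier : ZFSet.{u}
  [str : BooleanAlgebra carrier]

attribute [instance] SetBooleanAlgebra.str

namespace SetBooleanAlgebra

/-- The structure `(A, ∨, ∧, ¬, 0, 1)` as a single set, where the operations are identified with
their graphs. -/
noncomputable def code (A : SetBooleanAlgebra.{u}) : ZFSet.{u} :=
  .pair A.carrier <|
  .pair (.range fun p : A.carrier × A.carrier =>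
    .pair (.pair p.1.1 p.2.1) (p.1 ⊔ p.2 : A.carrier).1) <|
  .pair (.range fun p : A.carrier × A.carrier =>
    .pair (.pair p.1.1 p.2.1) (p.1 ⊓ p.2 : A.carrier).1) <|
  .pair (.range fun a : A.carrier => .pair a.1 (aᶜ : A.carrier).1) <|
  .pair (⊥ : A.carrier).1 (⊤ : A.carrier).1

/-- `A ∩ M ≤_sep A`, which includes that `A ∩ M` is a subalgebra of `A`. -/
def TraceSep (A : SetBooleanAlgebra.{u}) (M : Set ZFSet.{u}) : Prop :=
  ∃ N : BooleanSubalgebra A.carrier,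
    (N : Set A.carrier) = {a : A.carrier | (a : ZFSet.{u}) ∈ M} ∧ SepEmbedded N

/-- `A ∩ M ≤_σ A`, which includes that `A ∩ M` is a subalgebra of `A`. -/
def TraceSigma (A : SetBooleanAlgebra.{u}) (M : Set ZFSet.{u}) : Prop :=
  ∃ N : BooleanSubalgebra A.carrier,
    (N : Set A.carrier) = {a : A.carrier | (a : ZFSet.{u}) ∈ M} ∧ SigmaEmbedded N

/-- `SEP(A)`: for all sufficiently large regular `χ`, the good `M` with `A ∩ M ≤_sep A` are
cofinal in `[H_χ]^ℵ₁`. -/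
def SEP (A : SetBooleanAlgebra.{u}) : Prop :=
  ∃ κ : Cardinal.{u}, ∀ χ : Cardinal.{u}, κ < χ → χ.IsRegular →
    ∀ X : Set ZFSet.{u}, X ⊆ hereditarySets χ → #X = ℵ₁ →
      ∃ M ∈ goodSubmodels χ, X ⊆ M ∧ A.TraceSep M

/-- `IDP(A)`, the `(ℵ₁, ℵ₀)`-ideal property: for all sufficiently large regular `χ` and all good
`M` with `A ∈ M`, `A ∩ M ≤_σ A`. -/
def IDP (A : SetBooleanAlgebra.{u}) : Prop :=
  ∃ κ : Cardinal.{u}, ∀ χ : Cardinal.{u}, κ < χ → χ.IsRegular →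
    ∀ M ∈ goodSubmodels χ, A.code ∈ M → A.TraceSigma M

end SetBooleanAlgebra

/-! ### The algebras `A^S` -/

/-- The set of ordinals below `ω₂` of cofinality `ℵ₁`. -/
def cofOmegaOne : Set Ordinal.{u} :=
  {α | α < ω_ 2 ∧ α.cof = ℵ₁}

/-- `S` meets every closed unbounded subset of `ω₂`. -/
def IsStationaryInOmegaTwo (S : Set Ordinal.{u}) : Prop :=
  IsStationary (Subtype.val ⁻¹' S : Set (Set.Iio (ω_ 2 : Ordinal.{u})))

/-- `S₀` and `S₁` partition the set of ordinals below `ω₂` of cofinality `ℵ₁` into two stationary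
subsets of `ω₂`. -/
structure IsStationaryPartition (S₀ S₁ : Set Ordinal.{u}) : Prop where
  disjoint : Disjoint S₀ S₁
  union_eq : S₀ ∪ S₁ = cofOmegaOne
  stationary_left : IsStationaryInOmegaTwo S₀
  stationary_right : IsStationaryInOmegaTwo S₁

/-- For every `α < ω₂` of cofinality `ℵ₁`, `(δ α β)_{β < ω₁}` is an increasing sequence of
successor ordinals that is cofinal in `α`. -/
structure IsLadderSystem (δ : Ordinal.{u} → Ordinal.{u} → Ordinal.{u}) : Prop where
  strictMono : ∀ α ∈ cofOmegaOne, StrictMonoOn (δ α) (Set.Iio (ω_ 1))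
  lt : ∀ α ∈ cofOmegaOne, ∀ β < ω_ 1, δ α β < α
  cofinal : ∀ α ∈ cofOmegaOne, ∀ γ < α, ∃ β < ω_ 1, γ ≤ δ α β
  succ : ∀ α ∈ cofOmegaOne, ∀ β < ω_ 1, ∃ γ, δ α β = Order.succ γ

/-- `B` is the union of the increasing chain `(A α)_{α < ω₂}` of subalgebras, built by recursion
with the generators `(x α)_{α < ω₂}` as in the definition of the algebra `A^S`
(for the ladder system `δ`). -/
structure IsConstruction (S : Set Ordinal.{u}) (δ : Ordinal.{u} → Ordinal.{u} → Ordinal.{u})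
    {B : Type*} [BooleanAlgebra B] (A : Ordinal.{u} → BooleanSubalgebra B)
    (x : Ordinal.{u} → B) : Prop where
  bot_ne_top : (⊥ : B) ≠ ⊤
  /-- `A 0 = {0, 1}`. -/
  zero : (A 0 : Set B) = {⊥, ⊤}
  limit : ∀ α < ω_ 2, Order.IsSuccLimit α → (A α : Set B) = ⋃ β ∈ Set.Iio α, (A β : Set B)
  /-- `A (α + 1) = (A α)(x α)`. -/
  succ : ∀ α < ω_ 2, A (Order.succ α) = BooleanSubalgebra.closure (insert (x α) (A α : Set B))
  /-- For `α ∉ S`, `x α` is independent over `A α`. -/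
  independent : ∀ α < ω_ 2, α ∉ S → ∀ a ∈ A α, a ≠ ⊥ → a ⊓ x α ≠ ⊥ ∧ a ⊓ (x α)ᶜ ≠ ⊥
  notMem : ∀ α < ω_ 2, α ∈ S → x α ∉ A α
  /-- For `α ∈ S`, the ideal `A α ↾ x α` of `A α` is generated by `{x (δ α β) | β < ω₁}`. -/
  below : ∀ α < ω_ 2, α ∈ S → ∀ a ∈ A α, (a ≤ x α ↔
    ∃ t : Finset Ordinal.{u}, (∀ β ∈ t, β < ω_ 1) ∧ a ≤ t.sup fun β => x (δ α β))
  /-- For `α ∈ S`, `A α ↾ -x α = {0}`. -/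
  below_compl : ∀ α < ω_ 2, α ∈ S → ∀ a ∈ A α, a ≤ (x α)ᶜ → a = ⊥
  exhaust : ∀ b : B, ∃ α < ω_ 2, b ∈ A α

/-- The Boolean algebra `B` is (a copy of) the algebra `A^S` built with the ladder system `δ`. -/
def IsLadderAlgebra (S : Set Ordinal.{u}) (δ : Ordinal.{u} → Ordinal.{u} → Ordinal.{u})
    (B : Type*) [BooleanAlgebra B] : Prop :=
  ∃ (A : Ordinal.{u} → BooleanSubalgebra B) (x : Ordinal.{u} → B), IsConstruction S δ A x

/-!
Let `A = A^S` be filtered by the subalgebras `A_α`, and take a continuous increasing chain of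
elementary submodels of size `ℵ₁` whose countable subsets are covered by later members. The traces
of the chain on `A` and the `A_α` agree on a club, so for every stationary `S' ⊆ E` some model
`M ∈ 𝓜_χ` has `A ∩ M = A_α` with `α ∈ S'`.

If `α ∈ S`, the ideal `A_α ↾ x_α` is generated by the ladder `(x_{δ α β})_{β < ω₁}`. Countably many
elements of it involve only a bounded part of the ladder, and no generator lies below finitely many
earlier ones, so the ideal has no countable cofinal subset.

If `α ∉ S`, the separation property of `b ∈ A_β` over `A_α` is proved by induction on `β ≥ α`. When
`b = (u ∧ x_β) ∨ (v ∧ -x_β)` with `u, v ∈ A_β` and `β ∈ S`, choose `ρ < ω₁` with `α ≤ δ β ρ` and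
`v ∈ A_{δ β ρ}`. An element of `A_{δ β ρ}` below `x_β` lies below finitely many `x_{δ β γ}` with
`γ < ρ`, so the elements of `A_α` below `b` are covered by the countably many
`u ∧ (v ∨ x_{δ β γ₁} ∨ ⋯ ∨ x_{δ β γₙ}) ≤ b` of `A_β`, to which the induction hypothesis applies.

The algebra `A^S` itself consists of the clopen subsets of the space of those `p ⊆ ω₂` with
`α ∈ p` whenever `α ∈ S` and `p` meets the ladder at `α`.
-/

universe v w

/-! ### Stationary subsets of `ω₂` -/

theorem aleph_two_eq_succ : (ℵ_ 2 : Cardinal.{u}) = Order.succ ℵ₁ := by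
  rw [← one_add_one_eq_two, succ_aleph]

theorem aleph_one_lt_aleph_two : (ℵ₁ : Cardinal.{u}) < ℵ_ 2 :=
  aleph_two_eq_succ ▸ Order.lt_succ _

theorem isRegular_aleph_two : (ℵ_ 2 : Cardinal.{u}).IsRegular :=
  aleph_two_eq_succ ▸ isRegular_succ (aleph0_le_aleph 1)

theorem omega_one_lt_omega_two : (ω_ 1 : Ordinal.{u}) < ω_ 2 :=
  omega_lt_omega.2 one_lt_two

theorem mk_Iio_omega_one : #(Set.Iio (ω_ 1 : Ordinal.{u})) = ℵ₁ := by
  simp [Cardinal.mk_Iio_ordinal]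

theorem mk_Iio_le_of_lt_omega_two {α : Ordinal.{u}} (h : α < ω_ 2) : #(Set.Iio α) ≤ ℵ₁ := by
  have hcard : α.card ≤ ℵ₁ := by
    rwa [← ord_aleph, lt_ord, aleph_two_eq_succ, Order.lt_succ_iff] at h
  rw [Cardinal.mk_Iio_ordinal]
  simpa using Cardinal.lift_le.{u + 1}.2 hcard

theorem cof_Iio_omega_two : Order.cof (Set.Iio (ω_ 2 : Ordinal.{u})) = ℵ_ 2 := by
  rw [cof_Iio, ← lift_cof, isRegular_aleph_two.cof_omega_eq]
  simp

instance : IsRegularCardinalOrder (Set.Iio (ω_ 2 : Ordinal.{u})) where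
  type_lt_le_ord_cof := by
    simp [isRegular_aleph_two.cof_omega_eq]

theorem nonempty_orderIso_Iio_coe {α : Type v} [LinearOrder α] {a : α} (b : Set.Iio a) :
    Nonempty (Set.Iio b ≃o Set.Iio b.1) :=
  ⟨StrictMono.orderIsoOfSurjective
    (fun c => (⟨c.1.1, c.2⟩ : Set.Iio b.1)) (fun _ _ h => h)
    (fun c => ⟨⟨⟨c.1, c.2.trans b.2⟩, c.2⟩, rfl⟩)⟩

theorem mk_Iio_coe_omega_two_le (α : Set.Iio (ω_ 2 : Ordinal.{u})) : #(Set.Iio α) ≤ ℵ₁ :=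
  (nonempty_orderIso_Iio_coe α).elim fun e =>
    (mk_congr e.toEquiv).trans_le (mk_Iio_le_of_lt_omega_two α.2)

theorem cof_Iio_coe_omega_two (α : Set.Iio (ω_ 2 : Ordinal.{u})) :
    Order.cof (Set.Iio α) = Cardinal.lift.{u + 1} α.1.cof :=
  (nonempty_orderIso_Iio_coe α).elim fun e => by
    rw [e.cof_congr, cof_Iio, lift_cof]

section Club

variable {ι : Type v} [LinearOrder ι]

theorem cof_Iio_apply_of_isNormal {κ : Type v} [LinearOrder κ] {f : ι → κ}
    (hf : Order.IsNormal f) {a : ι} (ha : Order.IsSuccLimit a) :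
    Order.cof (Set.Iio (f a)) = Order.cof (Set.Iio a) := by
  refine (Order.cof_congr_of_strictMono
    (f := fun b : Set.Iio a => (⟨f b, hf.strictMono b.2⟩ : Set.Iio (f a)))
    (fun b c h => hf.strictMono h) ?_).symm
  rintro ⟨c, hc⟩
  obtain ⟨b, hb, hcb⟩ := (hf.lt_iff_exists_lt ha).1 hc
  exact ⟨_, ⟨⟨b, hb⟩, rfl⟩, hcb.le⟩

theorem exists_forall_lt_of_mk_lt_cof {s : Set ι} (hs : #s < Order.cof ι) :
    ∃ a, ∀ b ∈ s, b < a :=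
  not_isCofinal_iff.1 fun h => (Order.cof_le h).not_gt hs

theorem isClub_Ioi [NoMaxOrder ι] (a : ι) : IsClub (Set.Ioi a) :=
  ⟨(isUpperSet_Ioi a).dirSupClosed, fun b =>
    (exists_gt (max a b)).imp fun _ hc => ⟨(le_max_left a b).trans_lt hc,
      ((le_max_right a b).trans_lt hc).le⟩⟩

variable [WellFoundedLT ι]

theorem isStationary_setOf_cof_Iio_eq [IsRegularCardinalOrder ι] {a : ι}
    (ha : Order.IsSuccLimit a) :
    IsStationary {b : ι | Order.cof (Set.Iio b) = Order.cof (Set.Iio a)} := fun _ ht =>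
  ⟨_, cof_Iio_apply_of_isNormal ht.isNormal_enum ha, Subtype.prop _⟩

theorem isStationary_inter_isClub (hι : Order.cof ι ≠ ℵ₀) {S C : Set ι} (hS : IsStationary S)
    (hC : IsClub C) : IsStationary (S ∩ C) := fun t ht => by
  simpa only [Set.inter_assoc] using hS (hC.inter hι ht)

theorem isClub_closurePoints (hι : ℵ₀ < Order.cof ι) (hIio : ∀ a : ι, #(Set.Iio a) < Order.cof ι)
    (g : ι → ι) : IsClub {ξ | ∀ η < ξ, g η < ξ} := by
  refine ⟨fun d hd _ _ a ha η hη => ?_, fun a => ?_⟩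
  · obtain ⟨ξ, hξ, hηξ⟩ := (lt_isLUB_iff ha).1 hη
    exact (hd hξ η hηξ).trans_le (ha.1 hξ)
  · have hnext (b : ι) : ∃ c, ∀ η < b, g η < c := by
      obtain ⟨c, hc⟩ := exists_forall_lt_of_mk_lt_cof (mk_image_le.trans_lt (hIio b))
      exact ⟨c, fun η hη => hc _ ⟨η, hη, rfl⟩⟩
    choose next apply_lt_next using hnext
    have hbdd : (upperBounds (Set.range fun n => next^[n] a)).Nonempty := by
      obtain ⟨c, hc⟩ := exists_forall_lt_of_mk_lt_cof
        ((Set.countable_range fun n => next^[n] a).le_aleph0.trans_lt hι)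
      exact ⟨c, fun b hb => (hc b hb).le⟩
    obtain ⟨ξ, hξ, hmin⟩ := wellFounded_lt.has_min _ hbdd
    have hle (n : ℕ) : next^[n] a ≤ ξ := hξ ⟨n, rfl⟩
    refine ⟨ξ, fun η hη => ?_, hle 0⟩
    obtain ⟨n, hn⟩ : ∃ n, η < next^[n] a := by
      by_contra! h
      exact hmin η (Set.forall_mem_range.2 h) hη
    have hsucc (n : ℕ) : next^[n + 1] a = next (next^[n] a) := Function.iterate_succ_apply' _ _ _
    calc g η < next^[n + 1] a := hsucc n ▸ apply_lt_next _ η hn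
      _ ≤ ξ := hle _

-- Ulam's matrix: `number a` numbers the elements below `a` by `κ` labels. Each `b` gets a label
-- which it carries for stationarily many `a ∈ S`, and two elements must share their label.
theorem exists_subset_isStationary_diff {κ : Cardinal.{v}} (hκ : ℵ₀ ≤ κ) (hι : κ < Order.cof ι)
    (hIio : ∀ a : ι, #(Set.Iio a) ≤ κ) {S : Set ι} (hS : IsStationary S) :
    ∃ T ⊆ S, IsStationary T ∧ IsStationary (S \ T) := by
  have hne : Order.cof ι ≠ ℵ₀ := (hκ.trans_lt hι).ne'
  have : NoMaxOrder ι := ⟨fun a => by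
    obtain ⟨b, hb⟩ := exists_forall_lt_of_mk_lt_cof (s := {a}) (by
      simpa using one_lt_aleph0.trans (hκ.trans_lt hι))
    exact ⟨b, hb a rfl⟩⟩
  have hemb (a : ι) : Nonempty (Set.Iio a ↪ κ.out) := by
    rw [← Cardinal.le_def, mk_out]
    exact hIio a
  let number (a : ι) : Set.Iio a ↪ κ.out := (hemb a).some
  let U (b : ι) (k : κ.out) : Set ι := {a ∈ S | ∃ h : b < a, number a ⟨b, h⟩ = k}
  have hU (b : ι) : ∃ k, IsStationary (U b k) := by
    refine (isStationary_iUnion_iff hne (by simpa using hι)).1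
      ((isStationary_inter_isClub hne hS (isClub_Ioi b)).mono ?_)
    rintro a ⟨haS, hba⟩
    exact Set.mem_iUnion.2 ⟨_, haS, hba, rfl⟩
  choose label hlabel using hU
  obtain ⟨b, c, hbc, hne⟩ : ∃ b c, label b = label c ∧ b ≠ c := by
    by_contra! hinj
    exact (hι.trans_le (Order.cof_le_cardinalMk ι)).not_ge (by simpa using mk_le_of_injective hinj)
  refine ⟨U b (label b), fun a ha => ha.1, hlabel b, (hlabel c).mono ?_⟩
  rintro a ⟨haS, hca, hac⟩
  refine ⟨haS, fun ⟨_, hba, hab⟩ => hne ?_⟩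
  exact congrArg Subtype.val ((number a).injective (hab.trans (hbc.trans hac.symm)))

end Club

theorem isStationary_cofOmegaOne : IsStationaryInOmegaTwo cofOmegaOne.{u} := by
  let ω₁' : Set.Iio (ω_ 2 : Ordinal.{u}) := ⟨ω_ 1, omega_one_lt_omega_two⟩
  have hcof : Order.cof (Set.Iio ω₁') = ℵ₁ := by
    simp [cof_Iio_coe_omega_two, ω₁']
  refine (isStationary_setOf_cof_Iio_eq (a := ω₁') ?_).mono fun α hα => ⟨α.2, ?_⟩
  · refine ⟨not_isMin_of_lt (b := ⟨0, omega_pos 2⟩) (omega_pos 1), fun β hβ => ?_⟩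
    have hsucc : Order.succ β.1 < ω_ 1 := (isSuccLimit_omega 1).succ_lt hβ.1
    exact hβ.2 (c := ⟨Order.succ β.1, hsucc.trans omega_one_lt_omega_two⟩)
      (Order.lt_succ β.1) hsucc
  · rw [Set.mem_ofPred_eq, hcof, cof_Iio_coe_omega_two] at hα
    exact Cardinal.lift_injective (hα.trans (by simp))

theorem exists_isStationaryPartition : ∃ S₀ S₁ : Set Ordinal.{u}, IsStationaryPartition S₀ S₁ := by
  obtain ⟨T, hTE, hT, hdiff⟩ := exists_subset_isStationary_diff (aleph0_le_aleph 1)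
    (cof_Iio_omega_two ▸ aleph_one_lt_aleph_two) mk_Iio_coe_omega_two_le isStationary_cofOmegaOne
  have himage : Subtype.val '' T ⊆ cofOmegaOne := Set.image_subset_iff.2 hTE
  refine ⟨Subtype.val '' T, cofOmegaOne \ Subtype.val '' T, Set.disjoint_sdiff_right,
    Set.union_sdiff_cancel himage, ?_, ?_⟩
  · rwa [IsStationaryInOmegaTwo, Set.preimage_image_eq _ Subtype.val_injective]
  · rwa [IsStationaryInOmegaTwo, Set.preimage_sdiff,
      Set.preimage_image_eq _ Subtype.val_injective]

theorem isSuccLimit_of_mem_cofOmegaOne {α : Ordinal.{u}} (h : α ∈ cofOmegaOne) :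
    Order.IsSuccLimit α := by
  rw [← one_lt_cof_iff, h.2]
  exact one_lt_aleph0.trans aleph0_lt_aleph_one

theorem exists_forall_lt_of_countable {α : Ordinal.{u}} (hα : ℵ₀ < α.cof) {s : Set Ordinal.{u}}
    (hs : s.Countable) (h : ∀ β ∈ s, β < α) : ∃ γ < α, ∀ β ∈ s, β < γ := by
  have hlim : Order.IsSuccLimit α := one_lt_cof_iff.1 (one_lt_aleph0.trans hα)
  have hlt : sSup s < α :=
    sSup_lt_of_lt_cof (hs.le_aleph0.trans_lt (by rwa [← lift_cof, aleph0_lt_lift])) h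
  exact ⟨Order.succ (sSup s), hlim.succ_lt hlt, fun β hβ =>
    Order.lt_succ_iff.2 (le_csSup ⟨α, fun β hβ => (h β hβ).le⟩ hβ)⟩

theorem exists_isLadderSystem : ∃ δ : Ordinal.{u} → Ordinal.{u} → Ordinal.{u},
    IsLadderSystem δ := by
  have hladder (α : Ordinal.{u}) (hα : α ∈ cofOmegaOne) : ∃ d : Ordinal.{u} → Ordinal.{u},
      StrictMonoOn d (Set.Iio (ω_ 1)) ∧ (∀ β < ω_ 1, d β < α) ∧
      (∀ γ < α, ∃ β < ω_ 1, γ ≤ d β) ∧ ∀ β < ω_ 1, ∃ γ, d β = Order.succ γ := by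
    obtain ⟨f, hf⟩ := exists_isFundamentalSeq (o := α) (a := ω_ 1) (by rw [hα.2, ord_aleph])
    let d (β : Ordinal.{u}) : Ordinal.{u} :=
      if h : β < ω_ 1 then Order.succ (f ⟨β, h⟩).1 else 0
    have hd {β : Ordinal.{u}} (h : β < ω_ 1) : d β = Order.succ (f ⟨β, h⟩).1 := dif_pos h
    refine ⟨d, fun β hβ γ hγ h => ?_, fun β hβ => ?_, fun γ hγ => ?_,
      fun β hβ => ⟨f ⟨β, hβ⟩, hd hβ⟩⟩
    · have hlt : (⟨β, hβ⟩ : Set.Iio (ω_ 1)) < ⟨γ, hγ⟩ := h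
      rw [hd hβ, hd hγ]
      exact Order.succ_lt_succ (hf.strictMono hlt)
    · rw [hd hβ]
      exact (isSuccLimit_of_mem_cofOmegaOne hα).succ_lt (f ⟨β, hβ⟩).2
    · obtain ⟨_, ⟨β, rfl⟩, hβ⟩ := hf.isCofinal_range ⟨γ, hγ⟩
      exact ⟨β, β.2, (hd β.2).symm ▸ le_trans hβ (Order.le_succ (f β).1)⟩
  choose! δ hmono hlt hcof hsucc using hladder
  exact ⟨δ, hmono, hlt, hcof, hsucc⟩

/-! ### Simple extensions of Boolean subalgebras -/

section SimpleExtension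

variable {B : Type v} [BooleanAlgebra B]

theorem compl_inf_sup_inf_compl (u v x : B) : (u ⊓ x ⊔ v ⊓ xᶜ)ᶜ = uᶜ ⊓ x ⊔ vᶜ ⊓ xᶜ := by
  have hdisj : Disjoint x xᶜ := disjoint_compl_right
  refine IsCompl.compl_eq ⟨?_, ?_⟩
  · simp only [disjoint_sup_left, disjoint_sup_right]
    exact ⟨⟨disjoint_compl_right.mono inf_le_left inf_le_left, hdisj.symm.mono inf_le_right
      inf_le_right⟩, hdisj.mono inf_le_right inf_le_right,
      disjoint_compl_right.mono inf_le_left inf_le_left⟩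
  · rw [codisjoint_iff, sup_sup_sup_comm, ← inf_sup_right, ← inf_sup_right, sup_compl_eq_top,
      sup_compl_eq_top, top_inf_eq, top_inf_eq, sup_compl_eq_top]

theorem le_inf_sup_inf_compl_iff {c u v x : B} :
    c ≤ u ⊓ x ⊔ v ⊓ xᶜ ↔ c ⊓ x ≤ u ∧ c ⊓ xᶜ ≤ v := by
  refine ⟨fun h => ⟨?_, ?_⟩, fun ⟨hu, hv⟩ => ?_⟩
  · exact (inf_le_inf_right x h).trans (by simp [inf_sup_right, inf_assoc])
  · exact (inf_le_inf_right xᶜ h).trans (by simp [inf_sup_right, inf_assoc])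
  · calc c = c ⊓ x ⊔ c ⊓ xᶜ := by rw [← inf_sup_left, sup_compl_eq_top, inf_top_eq]
      _ ≤ u ⊓ x ⊔ v ⊓ xᶜ := sup_le_sup (le_inf hu inf_le_right) (le_inf hv inf_le_right)

theorem mem_closure_insert_iff {A : BooleanSubalgebra B} {x b : B} :
    b ∈ BooleanSubalgebra.closure (insert x (A : Set B)) ↔
      ∃ u ∈ A, ∃ v ∈ A, b = u ⊓ x ⊔ v ⊓ xᶜ := by
  constructor
  · intro hb
    induction hb using BooleanSubalgebra.closure_bot_sup_induction with
    | mem b hb =>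
      rcases hb with rfl | hb
      · exact ⟨⊤, BooleanSubalgebra.top_mem, ⊥, BooleanSubalgebra.bot_mem, by simp⟩
      · exact ⟨b, hb, b, hb, by rw [← inf_sup_left, sup_compl_eq_top, inf_top_eq]⟩
    | bot => exact ⟨⊥, BooleanSubalgebra.bot_mem, ⊥, BooleanSubalgebra.bot_mem, by simp⟩
    | sup _ _ _ _ h₁ h₂ =>
      obtain ⟨u, hu, v, hv, rfl⟩ := h₁
      obtain ⟨u', hu', v', hv', rfl⟩ := h₂
      exact ⟨u ⊔ u', BooleanSubalgebra.sup_mem hu hu', v ⊔ v', BooleanSubalgebra.sup_mem hv hv',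
        by rw [inf_sup_right, inf_sup_right, sup_sup_sup_comm]⟩
    | compl _ _ h =>
      obtain ⟨u, hu, v, hv, rfl⟩ := h
      exact ⟨uᶜ, BooleanSubalgebra.compl_mem hu, vᶜ, BooleanSubalgebra.compl_mem hv,
        compl_inf_sup_inf_compl u v x⟩
  · rintro ⟨u, hu, v, hv, rfl⟩
    have hA {a : B} (ha : a ∈ A) : a ∈ BooleanSubalgebra.closure (insert x (A : Set B)) :=
      BooleanSubalgebra.subset_closure (Or.inr ha)
    have hx : x ∈ BooleanSubalgebra.closure (insert x (A : Set B)) :=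
      BooleanSubalgebra.subset_closure (Or.inl rfl)
    exact BooleanSubalgebra.sup_mem (BooleanSubalgebra.inf_mem (hA hu) hx)
      (BooleanSubalgebra.inf_mem (hA hv) (BooleanSubalgebra.compl_mem hx))

theorem mk_closure_insert_le {A : BooleanSubalgebra B} {κ : Cardinal.{v}} (hκ : ℵ₀ ≤ κ)
    (hA : #A ≤ κ) (x : B) : #(BooleanSubalgebra.closure (insert x (A : Set B))) ≤ κ := by
  have hsub : (BooleanSubalgebra.closure (insert x (A : Set B)) : Set B) ⊆
      Set.image2 (fun u v => u ⊓ x ⊔ v ⊓ xᶜ) A A := fun b hb => by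
    obtain ⟨u, hu, v, hv, rfl⟩ := mem_closure_insert_iff.1 hb
    exact ⟨u, hu, v, hv, rfl⟩
  calc #(BooleanSubalgebra.closure (insert x (A : Set B))) ≤ #A * #A :=
      (mk_le_mk_of_subset hsub).trans mk_image2_le
    _ ≤ κ * κ := mul_le_mul' hA hA
    _ = κ := mul_eq_self hκ

/-- `x` meets every nonzero element of the subalgebra `A`. Independence of `x` over `A` is density
of both `x` and its complement. -/
def IsDenseOver (A : BooleanSubalgebra B) (x : B) : Prop :=
  ∀ a ∈ A, Disjoint a x → a = ⊥

theorem IsDenseOver.le_of_inf_le {A : BooleanSubalgebra B} {x a b : B} (hx : IsDenseOver A x)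
    (ha : a ∈ A) (hb : b ∈ A) (hle : a ⊓ x ≤ b) : a ≤ b := by
  rw [← sdiff_eq_bot_iff]
  refine hx _ (BooleanSubalgebra.sdiff_mem ha hb) (disjoint_iff.2 ?_)
  rwa [sdiff_eq, inf_right_comm, ← sdiff_eq, sdiff_eq_bot_iff]

end SimpleExtension

theorem mk_iUnion_le_aleph_one {B : Type u} {ι : Type v} (hι : #ι ≤ ℵ₁) {f : ι → Set B}
    (hf : ∀ i, #(f i) ≤ ℵ₁) : #(⋃ i, f i) ≤ ℵ₁ := by
  have hι' : Cardinal.lift.{u} #ι ≤ ℵ₁ := by simpa using Cardinal.lift_le.{u}.2 hι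
  have hf' : ⨆ i, Cardinal.lift.{v} #(f i) ≤ ℵ₁ :=
    ciSup_le' fun i => by simpa using Cardinal.lift_le.{v}.2 (hf i)
  rw [← Cardinal.lift_le.{v}, Cardinal.lift_aleph, Ordinal.lift_one]
  calc _ ≤ _ := mk_iUnion_le_lift f
    _ ≤ ℵ₁ * ℵ₁ := mul_le_mul' hι' hf'
    _ = ℵ₁ := mul_eq_self aleph0_lt_aleph_one.le

section Generators

variable {B : Type v} [BooleanAlgebra B] (x : Ordinal.{u} → B)

/-- The subalgebra generated by the first `α` elements of a sequence. -/
def initialClosure (α : Ordinal.{u}) : BooleanSubalgebra B :=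
  BooleanSubalgebra.closure (x '' Set.Iio α)

theorem initialClosure_mono : Monotone (initialClosure x) := fun _ _ h =>
  BooleanSubalgebra.closure_mono (Set.image_mono (Set.Iio_subset_Iio h))

theorem mem_initialClosure {α β : Ordinal.{u}} (h : β < α) : x β ∈ initialClosure x α :=
  BooleanSubalgebra.subset_closure (Set.mem_image_of_mem _ h)

theorem initialClosure_zero : initialClosure x 0 = ⊥ := by
  rw [eq_bot_iff, initialClosure, BooleanSubalgebra.closure_le]
  rintro _ ⟨β, hβ, _⟩
  exact (not_lt_bot (a := β) hβ).elim

theorem initialClosure_succ (α : Ordinal.{u}) : initialClosure x (Order.succ α) =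
    BooleanSubalgebra.closure (insert (x α) (initialClosure x α : Set B)) := by
  apply le_antisymm <;> rw [initialClosure, BooleanSubalgebra.closure_le]
  · rintro _ ⟨β, hβ, rfl⟩
    rcases (Order.lt_succ_iff.1 (Set.mem_Iio.1 hβ)).lt_or_eq with h | rfl
    · exact BooleanSubalgebra.subset_closure (Or.inr (mem_initialClosure x h))
    · exact BooleanSubalgebra.subset_closure (Or.inl rfl)
  · rintro a (rfl | h)
    · exact mem_initialClosure x (Order.lt_succ α)
    · exact initialClosure_mono x (Order.le_succ α) h

theorem mem_initialClosure_iff_of_isSuccLimit {α : Ordinal.{u}} (hα : Order.IsSuccLimit α) {a : B} :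
    a ∈ initialClosure x α ↔ ∃ β < α, a ∈ initialClosure x β := by
  refine ⟨fun ha => ?_, fun ⟨β, hβ, ha⟩ => initialClosure_mono x hβ.le ha⟩
  induction ha using BooleanSubalgebra.closure_bot_sup_induction with
  | mem a ha =>
    obtain ⟨β, hβ, rfl⟩ := ha
    exact ⟨_, hα.succ_lt hβ, mem_initialClosure x (Order.lt_succ β)⟩
  | bot => exact ⟨0, hα.bot_lt, BooleanSubalgebra.bot_mem⟩
  | sup a _ b _ h₁ h₂ =>
    obtain ⟨β, hβ, ha⟩ := h₁
    obtain ⟨γ, hγ, hb⟩ := h₂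
    exact ⟨max β γ, max_lt hβ hγ, BooleanSubalgebra.sup_mem
      (initialClosure_mono x (le_max_left _ _) ha) (initialClosure_mono x (le_max_right _ _) hb)⟩
  | compl a _ h =>
    obtain ⟨β, hβ, ha⟩ := h
    exact ⟨β, hβ, BooleanSubalgebra.compl_mem ha⟩

theorem mk_initialClosure_le_aleph_one {α : Ordinal.{u}} (hα : α < ω_ 2) :
    #(initialClosure x α) ≤ ℵ₁ := by
  induction α using Ordinal.limitRecOn with
  | zero =>
    have hfin : (({⊥, ⊤} : Set B)).Countable := by simp
    rw [initialClosure_zero, ← SetLike.coe_sort_coe, BooleanSubalgebra.coe_bot]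
    exact hfin.le_aleph0.trans aleph0_lt_aleph_one.le
  | add_one α ih =>
    rw [← Order.succ_eq_add_one] at hα ⊢
    rw [initialClosure_succ]
    exact mk_closure_insert_le (aleph0_le_aleph 1) (ih ((Order.lt_succ α).trans hα)) (x α)
  | limit α hlim ih =>
    have hU : (initialClosure x α : Set B) = ⋃ β : Set.Iio α, (initialClosure x β.1 : Set B) := by
      ext a
      simp [mem_initialClosure_iff_of_isSuccLimit x hlim]
    rw [← SetLike.coe_sort_coe, hU]
    exact mk_iUnion_le_aleph_one (mk_Iio_le_of_lt_omega_two hα) fun β =>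
      ih β.1 β.2 (lt_trans β.2 hα)

end Generators

/-! ### The Stone space of a ladder algebra -/

theorem IsLadderSystem.apply_notMem {S : Set Ordinal.{u}}
    {δ : Ordinal.{u} → Ordinal.{u} → Ordinal.{u}} (hδ : IsLadderSystem δ) (hS : S ⊆ cofOmegaOne)
    {α β : Ordinal.{u}} (hα : α ∈ cofOmegaOne) (hβ : β < ω_ 1) : δ α β ∉ S := fun h => by
  obtain ⟨γ, hγ⟩ := hδ.succ α hα β hβ
  exact Order.not_isSuccLimit_succ γ (hγ ▸ isSuccLimit_of_mem_cofOmegaOne (hS h))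

theorem exists_setBooleanAlgebra_bijective (C : Type v) [BooleanAlgebra C] [Small.{u} C] :
    ∃ (A : SetBooleanAlgebra.{u}) (f : BoundedLatticeHom A.carrier C), Function.Bijective f := by
  let r : Shrink.{u} C → Shrink.{u} C → Prop := WellOrderingRel
  let label (c : C) : ZFSet.{u} := (typein r (equivShrink C c)).toZFSet
  have hlabel : Function.Injective label := fun a b h =>
    (equivShrink C).injective (typein_injective r (toZFSet_injective h))
  let E : ZFSet.range label ≃ C :=
    (Equiv.setCongr (ZFSet.coe_range label)).trans (Equiv.ofInjective label hlabel).symm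
  let : BooleanAlgebra (ZFSet.range label) := E.booleanAlgebra
  let f : BoundedLatticeHom (ZFSet.range label) C :=
    { toFun := E
      map_sup' := fun _ _ => E.apply_symm_apply _
      map_inf' := fun _ _ => E.apply_symm_apply _
      map_top' := E.apply_symm_apply _
      map_bot' := E.apply_symm_apply _ }
  exact ⟨⟨ZFSet.range label⟩, f, E.bijective⟩

/-- The Stone space of `A^S`: the sets of ordinals below `ω₂` that contain `α ∈ S` as soon as they
contain some point of the ladder at `α`. -/
def ladderSpace (S : Set Ordinal.{u}) (δ : Ordinal.{u} → Ordinal.{u} → Ordinal.{u}) :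
    Set (Set Ordinal.{u}) :=
  {p | p ∈ 𝒫 (Set.Iio (ω_ 2)) ∧ ∀ α ∈ S, ∀ β < ω_ 1, δ α β ∈ p → α ∈ p}

/-- The clopen set of points of the Stone space that contain `α`. -/
def ladderGen (S : Set Ordinal.{u}) (δ : Ordinal.{u} → Ordinal.{u} → Ordinal.{u})
    (α : Ordinal.{u}) : Set (ladderSpace S δ) :=
  {p | α ∈ p.1}

/-- `e` identifies `B` with the algebra of sets generated by the `ladderGen S δ α`, and `x α` with
`ladderGen S δ α`. -/
structure IsLadderRepresentation {S : Set Ordinal.{u}} {δ : Ordinal.{u} → Ordinal.{u} → Ordinal.{u}}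
    {B : Type v} [BooleanAlgebra B] (e : BoundedLatticeHom B (Set (ladderSpace S δ)))
    (x : Ordinal.{u} → B) : Prop where
  injective : Function.Injective e
  map_gen : ∀ α < ω_ 2, e (x α) = ladderGen S δ α
  apply_mem : ∀ b, e b ∈ BooleanSubalgebra.closure (ladderGen S δ '' Set.Iio (ω_ 2))

section Representation

variable {S : Set Ordinal.{u}} {δ : Ordinal.{u} → Ordinal.{u} → Ordinal.{u}}

instance : Small.{u} (ladderSpace S δ) :=
  small_subset (s := 𝒫 (Set.Iio (ω_ 2))) fun _ h => h.1

theorem empty_mem_ladderSpace : ∅ ∈ ladderSpace S δ :=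
  ⟨Set.empty_subset _, fun _ _ _ _ h => h.elim⟩

theorem exists_mem_ladderSpace_mem (hS : S ⊆ cofOmegaOne) (hδ : IsLadderSystem δ)
    (p : ladderSpace S δ) {α : Ordinal.{u}} (hα : α < ω_ 2) :
    ∃ q : ladderSpace S δ, (∀ γ < α, γ ∈ q.1 ↔ γ ∈ p.1) ∧ α ∈ q.1 := by
  refine ⟨⟨p.1 ∩ Set.Iio α ∪ Set.Ico α (ω_ 2), ?_, fun γ hγ β hβ h => ?_⟩, fun γ hγ => ?_,
    Or.inr ⟨le_rfl, hα⟩⟩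
  · exact Set.union_subset (Set.inter_subset_left.trans p.2.1) Set.Ico_subset_Iio_self
  · rcases lt_or_ge γ α with hlt | hle
    · have hδα : δ γ β < α := (hδ.lt γ (hS hγ) β hβ).trans hlt
      exact Or.inl ⟨p.2.2 γ hγ β hβ (h.resolve_right fun h => hδα.not_ge h.1).1, hlt⟩
    · exact Or.inr ⟨hle, (hS hγ).1⟩
  · simp [hγ, hγ.not_ge]

theorem exists_mem_ladderSpace_notMem (hS : S ⊆ cofOmegaOne) (hδ : IsLadderSystem δ)
    (p : ladderSpace S δ) {α : Ordinal.{u}} (hα : α ∈ S → ∀ β < ω_ 1, δ α β ∉ p.1) :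
    ∃ q : ladderSpace S δ, (∀ γ < α, γ ∈ q.1 ↔ γ ∈ p.1) ∧ α ∉ q.1 := by
  refine ⟨⟨p.1 ∩ Set.Iio α ∪ Set.Ioo α (ω_ 2), ?_, fun γ hγ β hβ h => ?_⟩, fun γ hγ => ?_,
    by simp⟩
  · exact Set.union_subset (Set.inter_subset_left.trans p.2.1) Set.Ioo_subset_Iio_self
  · rcases lt_or_ge α γ with hlt | hle
    · exact Or.inr ⟨hlt, (hS hγ).1⟩
    · have hδα : δ γ β < α := (hδ.lt γ (hS hγ) β hβ).trans_le hle
      have hp : δ γ β ∈ p.1 := (h.resolve_right fun h => hδα.not_gt h.1).1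
      exact Or.inl ⟨p.2.2 γ hγ β hβ hp, hle.lt_of_ne fun h => hα (h ▸ hγ) β hβ (h ▸ hp)⟩
  · simp [hγ, hγ.not_gt]

theorem sdiff_ladder_mem_ladderSpace (hS : S ⊆ cofOmegaOne) (hδ : IsLadderSystem δ)
    {p : Set Ordinal.{u}} (hp : p ∈ ladderSpace S δ) {α : Ordinal.{u}} (hα : α ∈ S) :
    p \ (δ α '' Set.Iio (ω_ 1)) ∈ ladderSpace S δ := by
  refine ⟨fun γ h => hp.1 h.1, fun γ hγ β hβ h => ⟨hp.2 γ hγ β hβ h.1, ?_⟩⟩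
  rintro ⟨β', hβ', rfl⟩
  exact hδ.apply_notMem hS (hS hα) hβ' hγ

namespace IsLadderRepresentation

variable {B : Type v} [BooleanAlgebra B] {e : BoundedLatticeHom B (Set (ladderSpace S δ))}
  {x : Ordinal.{u} → B}

theorem le_iff (h : IsLadderRepresentation e x) {a b : B} : a ≤ b ↔ e a ⊆ e b := by
  rw [← inf_eq_left, ← h.injective.eq_iff, map_inf]
  exact inf_eq_left

theorem exists_mem (h : IsLadderRepresentation e x) {a : B} (ha : a ≠ ⊥) : ∃ p, p ∈ e a := by
  rw [← Set.nonempty_def, Set.nonempty_iff_ne_empty]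
  exact fun he => ha (h.injective (he.trans (map_bot e).symm))

theorem exists_finset_support (h : IsLadderRepresentation e x) {α : Ordinal.{u}} (hα : α < ω_ 2)
    {a : B} (ha : a ∈ initialClosure x α) :
    ∃ F : Finset Ordinal.{u}, (∀ γ ∈ F, γ < α) ∧ ∀ p q : ladderSpace S δ,
      (∀ γ ∈ F, γ ∈ p.1 ↔ γ ∈ q.1) → (p ∈ e a ↔ q ∈ e a) := by
  classical
  induction ha using BooleanSubalgebra.closure_bot_sup_induction with
  | mem a ha =>
    obtain ⟨β, hβ, rfl⟩ := ha
    refine ⟨{β}, by simpa using hβ, fun p q hpq => ?_⟩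
    rw [h.map_gen β (lt_trans hβ hα)]
    exact hpq β (Finset.mem_singleton_self β)
  | bot => exact ⟨∅, by simp, fun p q _ => by simp⟩
  | sup a _ b _ h₁ h₂ =>
    obtain ⟨F, hFα, hF⟩ := h₁
    obtain ⟨G, hGα, hG⟩ := h₂
    refine ⟨F ∪ G, fun γ hγ => (Finset.mem_union.1 hγ).elim (hFα γ) (hGα γ), fun p q hpq => ?_⟩
    rw [map_sup]
    exact or_congr (hF p q fun γ hγ => hpq γ (Finset.mem_union_left _ hγ))
      (hG p q fun γ hγ => hpq γ (Finset.mem_union_right _ hγ))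
  | compl a _ h =>
    obtain ⟨F, hFα, hF⟩ := h
    refine ⟨F, hFα, fun p q hpq => ?_⟩
    rw [map_compl']
    exact not_congr (hF p q hpq)

theorem mem_congr (h : IsLadderRepresentation e x) {α : Ordinal.{u}} (hα : α < ω_ 2) {a : B}
    (ha : a ∈ initialClosure x α) {p q : ladderSpace S δ} (hpq : ∀ γ < α, γ ∈ p.1 ↔ γ ∈ q.1) :
    p ∈ e a ↔ q ∈ e a := by
  obtain ⟨F, hFα, hF⟩ := h.exists_finset_support hα ha
  exact hF p q fun γ hγ => hpq γ (hFα γ hγ)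

theorem isDenseOver_gen (h : IsLadderRepresentation e x) (hS : S ⊆ cofOmegaOne)
    (hδ : IsLadderSystem δ) {α : Ordinal.{u}} (hα : α < ω_ 2) :
    IsDenseOver (initialClosure x α) (x α) := fun a ha hdisj => by
  by_contra hne
  obtain ⟨p, hp⟩ := h.exists_mem hne
  obtain ⟨q, hqp, hq⟩ := exists_mem_ladderSpace_mem hS hδ p hα
  refine Set.disjoint_left.1 (hdisj.map e) ((h.mem_congr hα ha hqp).2 hp) ?_
  rwa [h.map_gen α hα]

theorem isDenseOver_compl_gen (h : IsLadderRepresentation e x) (hS : S ⊆ cofOmegaOne)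
    (hδ : IsLadderSystem δ) {α : Ordinal.{u}} (hα : α < ω_ 2) (hαS : α ∉ S) :
    IsDenseOver (initialClosure x α) (x α)ᶜ := fun a ha hdisj => by
  by_contra hne
  obtain ⟨p, hp⟩ := h.exists_mem hne
  obtain ⟨q, hqp, hq⟩ := exists_mem_ladderSpace_notMem hS hδ p (α := α) fun h => (hαS h).elim
  refine Set.disjoint_left.1 (hdisj.map e) ((h.mem_congr hα ha hqp).2 hp) ?_
  rwa [map_compl', h.map_gen α hα]

theorem gen_notMem (h : IsLadderRepresentation e x) (hS : S ⊆ cofOmegaOne) (hδ : IsLadderSystem δ)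
    {α : Ordinal.{u}} (hα : α < ω_ 2) : x α ∉ initialClosure x α := fun hx => by
  let p : ladderSpace S δ := ⟨∅, empty_mem_ladderSpace⟩
  obtain ⟨q, hqp, hq⟩ := exists_mem_ladderSpace_mem hS hδ p hα
  have hiff := h.mem_congr hα hx hqp
  rw [h.map_gen α hα] at hiff
  exact hiff.1 hq

theorem ladder_gen_le (h : IsLadderRepresentation e x) (hS : S ⊆ cofOmegaOne)
    (hδ : IsLadderSystem δ) {α β : Ordinal.{u}} (hα : α ∈ S) (hβ : β < ω_ 1) :
    x (δ α β) ≤ x α := by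
  rw [h.le_iff, h.map_gen α (hS hα).1, h.map_gen _ ((hδ.lt α (hS hα) β hβ).trans (hS hα).1)]
  exact fun p hp => p.2.2 α hα β hβ hp

theorem exists_le_sup_ladder (h : IsLadderRepresentation e x) (hS : S ⊆ cofOmegaOne)
    (hδ : IsLadderSystem δ) {α : Ordinal.{u}} (hα : α ∈ S) {a : B} (ha : a ∈ initialClosure x α)
    (hax : a ≤ x α) :
    ∃ t : Finset Ordinal.{u}, (∀ β ∈ t, β < ω_ 1) ∧ a ≤ t.sup fun β => x (δ α β) := by
  classical
  have hα₂ : α < ω_ 2 := (hS hα).1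
  obtain ⟨F, hFα, hF⟩ := h.exists_finset_support hα₂ ha
  obtain ⟨t, ht, htF⟩ := Finset.subset_set_image_iff.1
    (show (↑(F.filter (· ∈ δ α '' Set.Iio (ω_ 1))) : Set Ordinal.{u}) ⊆ δ α '' Set.Iio (ω_ 1) from
      fun γ hγ => (Finset.mem_filter.1 hγ).2)
  have hsup : (t.sup fun β => x (δ α β)) = (F.filter (· ∈ δ α '' Set.Iio (ω_ 1))).sup x := by
    rw [← htF, Finset.sup_image, Function.comp_def]
  refine ⟨t, ht, hsup ▸ h.le_iff.2 fun p hp => ?_⟩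
  -- Removing the ladder from a counterexample `p` yields a point of `a` that need not contain `α`.
  by_contra hnot
  have hfree : ∀ γ ∈ F, γ ∈ δ α '' Set.Iio (ω_ 1) → γ ∉ p.1 := fun γ hγ hγδ hγp => by
    refine hnot (h.le_iff.1 (Finset.le_sup (Finset.mem_filter.2 ⟨hγ, hγδ⟩)) ?_)
    rwa [h.map_gen γ ((hFα γ hγ).trans hα₂)]
  let q : ladderSpace S δ := ⟨_, sdiff_ladder_mem_ladderSpace hS hδ p.2 hα⟩
  have hqa : q ∈ e a :=
    (hF q p fun γ hγ => ⟨fun hq => hq.1, fun hp => ⟨hp, fun hγδ => hfree γ hγ hγδ hp⟩⟩).2 hp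
  obtain ⟨r, hrq, hr⟩ := exists_mem_ladderSpace_notMem hS hδ q (α := α)
    fun _ β hβ hq => hq.2 ⟨β, hβ, rfl⟩
  refine hr ?_
  have hra := h.le_iff.1 hax ((h.mem_congr hα₂ ha hrq).2 hqa)
  rwa [h.map_gen α hα₂] at hra

theorem mem_initialClosure_omega_two (h : IsLadderRepresentation e x) (b : B) :
    b ∈ initialClosure x (ω_ 2) := by
  have hle : BooleanSubalgebra.closure (ladderGen S δ '' Set.Iio (ω_ 2)) ≤
      (initialClosure x (ω_ 2)).map e := by
    rw [BooleanSubalgebra.closure_le]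
    rintro _ ⟨α, hα, rfl⟩
    exact ⟨x α, mem_initialClosure x hα, h.map_gen α hα⟩
  obtain ⟨c, hc, hcb⟩ := hle (h.apply_mem b)
  exact h.injective hcb ▸ hc

theorem isConstruction (h : IsLadderRepresentation e x) (hS : S ⊆ cofOmegaOne)
    (hδ : IsLadderSystem δ) : IsConstruction S δ (initialClosure x) x where
  bot_ne_top hbt := by
    have : Nonempty (ladderSpace S δ) := ⟨⟨∅, empty_mem_ladderSpace⟩⟩
    exact bot_ne_top (α := Set (ladderSpace S δ)) (by rw [← map_bot e, hbt, map_top])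
  zero := by rw [initialClosure_zero, BooleanSubalgebra.coe_bot]
  limit α _ hα := by
    ext a
    simp [mem_initialClosure_iff_of_isSuccLimit x hα]
  succ α _ := initialClosure_succ x α
  independent α hα hαS a ha hne :=
    ⟨fun hbot => hne (h.isDenseOver_gen hS hδ hα a ha (disjoint_iff.2 hbot)),
      fun hbot => hne (h.isDenseOver_compl_gen hS hδ hα hαS a ha (disjoint_iff.2 hbot))⟩
  notMem α hα _ := h.gen_notMem hS hδ hα
  below α _ hαS a ha := ⟨h.exists_le_sup_ladder hS hδ hαS ha, fun ⟨_, ht, hat⟩ =>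
    hat.trans (Finset.sup_le fun β hβ => h.ladder_gen_le hS hδ hαS (ht β hβ))⟩
  below_compl α hα _ a ha hax :=
    h.isDenseOver_gen hS hδ hα a ha (le_compl_iff_disjoint_right.1 hax)
  exhaust b := (mem_initialClosure_iff_of_isSuccLimit x (isSuccLimit_omega 2)).1
    (h.mem_initialClosure_omega_two b)

end IsLadderRepresentation

theorem exists_isLadderAlgebra (hS : S ⊆ cofOmegaOne) (hδ : IsLadderSystem δ) :
    ∃ A : SetBooleanAlgebra.{u}, IsLadderAlgebra S δ A.carrier := by
  let C : BooleanSubalgebra (Set (ladderSpace S δ)) :=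
    BooleanSubalgebra.closure (ladderGen S δ '' Set.Iio (ω_ 2))
  obtain ⟨A, f, hf⟩ := exists_setBooleanAlgebra_bijective.{u} C
  let e : BoundedLatticeHom A.carrier (Set (ladderSpace S δ)) := C.subtype.comp f
  have hgen (α : Ordinal.{u}) (hα : α < ω_ 2) : ∃ a, e a = ladderGen S δ α :=
    (hf.2 ⟨_, BooleanSubalgebra.subset_closure ⟨α, hα, rfl⟩⟩).imp fun _ => congrArg Subtype.val
  choose! x hx using hgen
  have he : IsLadderRepresentation e x :=
    ⟨C.subtype_injective.comp hf.1, hx, fun b => (f b).2⟩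
  exact ⟨A, _, x, he.isConstruction hS hδ⟩

end Representation

/-! ### Separation over the members of the filtration -/

/-- The instance at `b` of `N ≤_sep B`. -/
def SepAt {B : Type v} [BooleanAlgebra B] (N : BooleanSubalgebra B) (b : B) : Prop :=
  ∀ T : Set B, T ⊆ {a | a ∈ N ∧ a ≤ b} → ¬ T.Countable →
    ∃ a, a ∈ N ∧ a ≤ b ∧ ¬ {c | c ∈ T ∧ c ≤ a}.Countable

namespace SepAt

variable {B : Type v} [BooleanAlgebra B] {N : BooleanSubalgebra B} {b : B}

theorem of_mem (hb : b ∈ N) : SepAt N b := by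
  intro T hT hunc
  have hTb : {c | c ∈ T ∧ c ≤ b} = T := Set.sep_eq_self_iff_mem_true.2 fun _ hc => (hT hc).2
  exact ⟨b, hb, le_rfl, by rwa [hTb]⟩

theorem of_countable_cover {D : Set B} (hD : D.Countable) (hle : ∀ d ∈ D, d ≤ b)
    (hsep : ∀ d ∈ D, SepAt N d) (hcover : ∀ a ∈ N, a ≤ b → ∃ d ∈ D, a ≤ d) : SepAt N b := by
  intro T hT hunc
  obtain ⟨d, hd, hTd⟩ : ∃ d ∈ D, ¬ {c | c ∈ T ∧ c ≤ d}.Countable := by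
    by_contra! h
    refine hunc ((hD.biUnion h).mono fun c hc => ?_)
    obtain ⟨d, hd, hcd⟩ := hcover c (hT hc).1 (hT hc).2
    exact Set.mem_biUnion hd ⟨hc, hcd⟩
  obtain ⟨a, ha, had, hunc'⟩ := hsep d hd _ (fun c hc => ⟨(hT hc.1).1, hc.2⟩) hTd
  refine ⟨a, ha, had.trans (hle d hd), fun h => hunc' (h.mono fun c hc => ?_)⟩
  exact ⟨hc.1.1, hc.2⟩

end SepAt

theorem countable_setOf_finset_coe_subset {ι : Type v} {s : Set ι} (hs : s.Countable) :
    {t : Finset ι | ↑t ⊆ s}.Countable :=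
  .mono (fun t ht => by exact ⟨t.finite_toSet, ht⟩)
    ((Set.countable_ofPred_finite_subset hs).preimage Finset.coe_injective)

theorem countable_Iio_of_lt_omega_one {ρ : Ordinal.{u}} (hρ : ρ < ω_ 1) :
    (Set.Iio ρ).Countable := by
  have hcard : ρ.card ≤ ℵ₀ := by
    rwa [← ord_aleph, lt_ord, ← succ_aleph0, Order.lt_succ_iff] at hρ
  rw [← le_aleph0_iff_set_countable, Cardinal.mk_Iio_ordinal]
  exact lift_le_aleph0.2 hcard

namespace IsConstruction

variable {S : Set Ordinal.{u}} {δ : Ordinal.{u} → Ordinal.{u} → Ordinal.{u}} {B : Type v}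
  [BooleanAlgebra B] {A : Ordinal.{u} → BooleanSubalgebra B} {x : Ordinal.{u} → B}

theorem eq_initialClosure (h : IsConstruction S δ A x) {α : Ordinal.{u}} (hα : α < ω_ 2) :
    A α = initialClosure x α := by
  induction α using Ordinal.limitRecOn with
  | zero =>
    refine SetLike.coe_injective (h.zero.trans ?_)
    rw [initialClosure_zero, BooleanSubalgebra.coe_bot]
  | add_one α ih =>
    rw [← Order.succ_eq_add_one] at hα ⊢
    have hα' : α < ω_ 2 := (Order.lt_succ α).trans hα
    rw [h.succ α hα', ih hα', initialClosure_succ]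
  | limit α hlim ih =>
    refine SetLike.ext fun a => ?_
    rw [mem_initialClosure_iff_of_isSuccLimit x hlim, ← SetLike.mem_coe, h.limit α hα hlim]
    simp only [Set.mem_iUnion, Set.mem_Iio, exists_prop, SetLike.mem_coe]
    exact exists_congr fun β => and_congr_right fun hβ => by rw [ih β hβ (hβ.trans hα)]

theorem mono (h : IsConstruction S δ A x) {α β : Ordinal.{u}} (hαβ : α ≤ β) (hβ : β < ω_ 2) :
    A α ≤ A β := by
  rw [h.eq_initialClosure hβ, h.eq_initialClosure (hαβ.trans_lt hβ)]
  exact initialClosure_mono x hαβ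

theorem mk_le (h : IsConstruction S δ A x) {α : Ordinal.{u}} (hα : α < ω_ 2) : #(A α) ≤ ℵ₁ :=
  h.eq_initialClosure hα ▸ mk_initialClosure_le_aleph_one x hα

theorem gen_mem (h : IsConstruction S δ A x) {α β : Ordinal.{u}} (hαβ : α < β) (hβ : β < ω_ 2) :
    x α ∈ A β :=
  h.eq_initialClosure hβ ▸ mem_initialClosure x hαβ

theorem mem_iff_of_isSuccLimit (h : IsConstruction S δ A x) {α : Ordinal.{u}} (hα : α < ω_ 2)
    (hlim : Order.IsSuccLimit α) {a : B} : a ∈ A α ↔ ∃ β < α, a ∈ A β := by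
  rw [← SetLike.mem_coe, h.limit α hα hlim]
  simp

theorem sup_gen_mem (h : IsConstruction S δ A x) {t : Finset Ordinal.{u}} {β : Ordinal.{u}}
    (hβ : β < ω_ 2) (ht : ∀ γ ∈ t, γ < β) : t.sup x ∈ A β :=
  Finset.sup_induction BooleanSubalgebra.bot_mem (fun _ ha _ hb => BooleanSubalgebra.sup_mem ha hb)
    fun γ hγ => h.gen_mem (ht γ hγ) hβ

theorem isDenseOver_gen (h : IsConstruction S δ A x) {α : Ordinal.{u}} (hα : α < ω_ 2) :
    IsDenseOver (A α) (x α) := fun a ha hdisj => by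
  by_cases hαS : α ∈ S
  · exact h.below_compl α hα hαS a ha (le_compl_iff_disjoint_right.2 hdisj)
  · by_contra hne
    exact (h.independent α hα hαS a ha hne).1 hdisj.eq_bot

theorem isDenseOver_compl_gen (h : IsConstruction S δ A x) {α : Ordinal.{u}} (hα : α < ω_ 2)
    (hαS : α ∉ S) : IsDenseOver (A α) (x α)ᶜ := fun a ha hdisj => by
  by_contra hne
  exact (h.independent α hα hαS a ha hne).2 hdisj.eq_bot

theorem le_sup_filter_of_le_sup (h : IsConstruction S δ A x) {ξ : Ordinal.{u}} {a : B}
    (ha : a ∈ A ξ) {t : Finset Ordinal.{u}} (ht : ∀ γ ∈ t, γ < ω_ 2 ∧ γ ∉ S) (hle : a ≤ t.sup x) :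
    a ≤ (t.filter (· < ξ)).sup x := by
  induction t using Finset.induction_on_max with
  | empty => simpa using hle
  | insert γ t hmax ih =>
    rcases lt_or_ge γ ξ with hγξ | hξγ
    · have hlt : ∀ β ∈ insert γ t, β < ξ :=
        Finset.forall_mem_insert .. |>.2 ⟨hγξ, fun β hβ => (hmax β hβ).trans hγξ⟩
      rwa [Finset.filter_true_of_mem hlt]
    · obtain ⟨⟨hγ, hγS⟩, ht⟩ := Finset.forall_mem_insert .. |>.1 ht
      rw [Finset.filter_insert, if_neg hξγ.not_gt]
      refine ih ht ((h.isDenseOver_compl_gen hγ hγS).le_of_inf_le (h.mono hξγ hγ ha)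
        (h.sup_gen_mem hγ hmax) ?_)
      rwa [← sdiff_eq, sdiff_le_iff, ← Finset.sup_insert]

theorem sup_ladder_le (h : IsConstruction S δ A x) (hS : S ⊆ cofOmegaOne) (hδ : IsLadderSystem δ)
    {α : Ordinal.{u}} (hα : α ∈ S) {t : Finset Ordinal.{u}} (ht : ∀ β ∈ t, β < ω_ 1) :
    (t.image (δ α)).sup x ∈ A α ∧ (t.image (δ α)).sup x ≤ x α := by
  have hα₂ := (hS hα).1
  have hmem : (t.image (δ α)).sup x ∈ A α := h.sup_gen_mem hα₂ fun γ hγ => by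
    obtain ⟨β, hβ, rfl⟩ := Finset.mem_image.1 hγ
    exact hδ.lt α (hS hα) β (ht β hβ)
  exact ⟨hmem, (h.below α hα₂ hα _ hmem).2 ⟨t, ht, (Finset.sup_image _ _ _).le⟩⟩

theorem exists_le_sup_ladder (h : IsConstruction S δ A x) (hS : S ⊆ cofOmegaOne)
    (hδ : IsLadderSystem δ) {α ρ : Ordinal.{u}} (hα : α ∈ S) (hρ : ρ < ω_ 1) {a : B}
    (ha : a ∈ A (δ α ρ)) (hax : a ≤ x α) :
    ∃ t : Finset Ordinal.{u}, ↑t ⊆ Set.Iio ρ ∧ a ≤ (t.image (δ α)).sup x := by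
  have hE := hS hα
  obtain ⟨t, ht, hat⟩ :=
    (h.below α hE.1 hα a (h.mono (hδ.lt α hE ρ hρ).le hE.1 ha)).1 hax
  have hsup : a ≤ ((t.image (δ α)).filter (· < δ α ρ)).sup x := by
    refine h.le_sup_filter_of_le_sup ha (fun γ hγ => ?_) (hat.trans (Finset.sup_image _ _ _).ge)
    obtain ⟨β, hβ, rfl⟩ := Finset.mem_image.1 hγ
    exact ⟨(hδ.lt α hE β (ht β hβ)).trans hE.1, hδ.apply_notMem hS hE (ht β hβ)⟩
  refine ⟨t.filter (· < ρ), fun β hβ => (Finset.mem_filter.1 hβ).2, hsup.trans ?_⟩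
  refine Finset.sup_mono fun γ hγ => ?_
  obtain ⟨hγt, hγ⟩ := Finset.mem_filter.1 hγ
  obtain ⟨β, hβ, rfl⟩ := Finset.mem_image.1 hγt
  exact Finset.mem_image_of_mem _ (Finset.mem_filter.2
    ⟨hβ, ((hδ.strictMono α hE).lt_iff_lt (ht β hβ) hρ).1 hγ⟩)

theorem not_le_sup_ladder (h : IsConstruction S δ A x) (hS : S ⊆ cofOmegaOne)
    (hδ : IsLadderSystem δ) {α ρ : Ordinal.{u}} (hα : α ∈ cofOmegaOne) (hρ : ρ < ω_ 1)
    {t : Finset Ordinal.{u}} (ht : ∀ β ∈ t, β < ρ) : ¬ x (δ α ρ) ≤ (t.image (δ α)).sup x := by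
  intro hle
  have hlt (β : Ordinal.{u}) (hβ : β < ω_ 1) : δ α β < ω_ 2 := (hδ.lt α hα β hβ).trans hα.1
  have hsup : (t.image (δ α)).sup x ∈ A (δ α ρ) := h.sup_gen_mem (hlt ρ hρ) fun γ hγ => by
    obtain ⟨β, hβ, rfl⟩ := Finset.mem_image.1 hγ
    exact hδ.strictMono α hα ((ht β hβ).trans hρ) hρ (ht β hβ)
  have htop : ⊤ ≤ (t.image (δ α)).sup x :=
    (h.isDenseOver_gen (hlt ρ hρ)).le_of_inf_le BooleanSubalgebra.top_mem hsup
      (by rwa [top_inf_eq])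
  have hbot := h.le_sup_filter_of_le_sup (ξ := 0) BooleanSubalgebra.top_mem (fun γ hγ => by
    obtain ⟨β, hβ, rfl⟩ := Finset.mem_image.1 hγ
    exact ⟨hlt β ((ht β hβ).trans hρ), hδ.apply_notMem hS hα ((ht β hβ).trans hρ)⟩) htop
  rw [Finset.filter_false_of_mem fun γ _ => not_lt_zero, Finset.sup_empty, top_le_iff] at hbot
  exact h.bot_ne_top hbot

theorem not_sigmaEmbedded (h : IsConstruction S δ A x) (hS : S ⊆ cofOmegaOne)
    (hδ : IsLadderSystem δ) {α : Ordinal.{u}} (hα : α ∈ S) : ¬ SigmaEmbedded (A α) := by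
  intro hsig
  have hE := hS hα
  obtain ⟨C, hC, hCsub, hcof⟩ := hsig (x α)
  have hfin (c : B) (hc : c ∈ C) : ∃ t : Finset Ordinal.{u}, (∀ β ∈ t, β < ω_ 1) ∧
      c ≤ t.sup fun β => x (δ α β) := (h.below α hE.1 hα c (hCsub hc).1).1 (hCsub hc).2
  choose! t ht hct using hfin
  obtain ⟨ρ, hρ, hbound⟩ : ∃ ρ < ω_ 1, ∀ β ∈ ⋃ c ∈ C, (t c : Set Ordinal.{u}), β < ρ := by
    refine exists_forall_lt_of_countable (by simp)
      (hC.biUnion fun c _ => (t c).countable_toSet) fun β hβ => ?_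
    obtain ⟨c, hc, hβ⟩ := Set.mem_iUnion₂.1 hβ
    exact ht c hc β hβ
  have hρS : ∀ β ∈ ({ρ} : Finset Ordinal.{u}), β < ω_ 1 := by simpa using hρ
  obtain ⟨hmem, hle⟩ := h.sup_ladder_le hS hδ hα hρS
  rw [Finset.image_singleton, Finset.sup_singleton] at hmem hle
  obtain ⟨c, hc, hρc⟩ := hcof _ hmem hle
  refine h.not_le_sup_ladder hS hδ hE hρ (fun β hβ => hbound β (Set.mem_iUnion₂.2 ⟨c, hc, hβ⟩))
    ((hρc.trans (hct c hc)).trans (Finset.sup_image _ _ _).ge)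

theorem sepAt_succ_of_notMem (h : IsConstruction S δ A x) {α β : Ordinal.{u}} (hαβ : α ≤ β)
    (hβ : β < ω_ 2) (hβS : β ∉ S) (ih : ∀ b ∈ A β, SepAt (A α) b) {u v : B} (hu : u ∈ A β)
    (hv : v ∈ A β) : SepAt (A α) (u ⊓ x β ⊔ v ⊓ (x β)ᶜ) := by
  refine SepAt.of_countable_cover (Set.countable_singleton (u ⊓ v)) ?_ ?_ ?_
  · rintro _ rfl
    exact le_inf_sup_inf_compl_iff.2 ⟨inf_le_left.trans inf_le_left, inf_le_left.trans inf_le_right⟩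
  · rintro _ rfl
    exact ih _ (BooleanSubalgebra.inf_mem hu hv)
  · intro a ha hle
    obtain ⟨hau, hav⟩ := le_inf_sup_inf_compl_iff.1 hle
    have haβ : a ∈ A β := h.mono hαβ hβ ha
    exact ⟨_, rfl, le_inf ((h.isDenseOver_gen hβ).le_of_inf_le haβ hu hau)
      ((h.isDenseOver_compl_gen hβ hβS).le_of_inf_le haβ hv hav)⟩

theorem sepAt_succ_of_mem (h : IsConstruction S δ A x) (hS : S ⊆ cofOmegaOne)
    (hδ : IsLadderSystem δ) {α β : Ordinal.{u}} (hαβ : α < β) (hβS : β ∈ S)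
    (ih : ∀ b ∈ A β, SepAt (A α) b) {u v : B} (hu : u ∈ A β) (hv : v ∈ A β) :
    SepAt (A α) (u ⊓ x β ⊔ v ⊓ (x β)ᶜ) := by
  have hE := hS hβS
  obtain ⟨η, hηβ, hvη⟩ :=
    (h.mem_iff_of_isSuccLimit hE.1 (isSuccLimit_of_mem_cofOmegaOne hE)).1 hv
  obtain ⟨ρ, hρ, hle⟩ := hδ.cofinal β hE (max α η) (max_lt hαβ hηβ)
  obtain ⟨hαρ, hηρ⟩ := max_le_iff.1 hle
  have hρ₂ : δ β ρ < ω_ 2 := (hδ.lt β hE ρ hρ).trans hE.1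
  let d (t : Finset Ordinal.{u}) : B := u ⊓ (v ⊔ (t.image (δ β)).sup x)
  refine SepAt.of_countable_cover (D := d '' {t | ↑t ⊆ Set.Iio ρ})
    ((countable_setOf_finset_coe_subset (countable_Iio_of_lt_omega_one hρ)).image d) ?_ ?_ ?_
  · rintro _ ⟨t, ht, rfl⟩
    have hsup := (h.sup_ladder_le hS hδ hβS fun γ hγ => (ht hγ).trans hρ).2
    refine le_inf_sup_inf_compl_iff.2 ⟨inf_le_left.trans inf_le_left, ?_⟩
    rw [← sdiff_eq, sdiff_le_iff, sup_comm]
    exact inf_le_right.trans (sup_le_sup_left hsup v)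
  · rintro _ ⟨t, ht, rfl⟩
    have hsup := (h.sup_ladder_le hS hδ hβS fun γ hγ => (ht hγ).trans hρ).1
    exact ih _ (BooleanSubalgebra.inf_mem hu (BooleanSubalgebra.sup_mem hv hsup))
  · intro a ha hle
    obtain ⟨hau, hav⟩ := le_inf_sup_inf_compl_iff.1 hle
    have hmem : a \ v ∈ A (δ β ρ) :=
      BooleanSubalgebra.sdiff_mem (h.mono hαρ hρ₂ ha) (h.mono hηρ hρ₂ hvη)
    rw [← sdiff_eq, sdiff_le_comm] at hav
    obtain ⟨t, ht, hat⟩ := h.exists_le_sup_ladder hS hδ hβS hρ hmem hav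
    exact ⟨d t, ⟨t, ht, rfl⟩, le_inf
      ((h.isDenseOver_gen hE.1).le_of_inf_le (h.mono hαβ.le hE.1 ha) hu hau) (sdiff_le_iff.1 hat)⟩

theorem sepAt_of_mem (h : IsConstruction S δ A x) (hS : S ⊆ cofOmegaOne)
    (hδ : IsLadderSystem δ) {α : Ordinal.{u}} (hα : α < ω_ 2) (hαS : α ∉ S)
    {β : Ordinal.{u}} (hβ : β < ω_ 2) {b : B} (hb : b ∈ A β) : SepAt (A α) b := by
  induction β using Ordinal.limitRecOn generalizing b with
  | zero => exact SepAt.of_mem (h.mono zero_le hα hb)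
  | add_one β ih =>
    rw [← Order.succ_eq_add_one] at hβ hb
    have hβ' : β < ω_ 2 := (Order.lt_succ β).trans hβ
    rcases le_or_gt (Order.succ β) α with hle | hlt
    · exact SepAt.of_mem (h.mono hle hα hb)
    rw [Order.lt_succ_iff] at hlt
    rw [h.succ β hβ'] at hb
    obtain ⟨u, hu, v, hv, rfl⟩ := mem_closure_insert_iff.1 hb
    by_cases hβS : β ∈ S
    · exact h.sepAt_succ_of_mem hS hδ (hlt.lt_of_ne fun he => hαS (he ▸ hβS)) hβS
        (fun _ => ih hβ') hu hv
    · exact h.sepAt_succ_of_notMem hlt hβ' hβS (fun _ => ih hβ') hu hv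
  | limit β hlim ih =>
    obtain ⟨γ, hγ, hb'⟩ := (h.mem_iff_of_isSuccLimit hβ hlim).1 hb
    exact ih γ hγ (hγ.trans hβ) hb'

theorem sepEmbedded (h : IsConstruction S δ A x) (hS : S ⊆ cofOmegaOne)
    (hδ : IsLadderSystem δ) {α : Ordinal.{u}} (hα : α < ω_ 2) (hαS : α ∉ S) :
    SepEmbedded (A α) := fun b => by
  obtain ⟨β, hβ, hb⟩ := h.exhaust b
  exact h.sepAt_of_mem hS hδ hα hαS hβ hb

end IsConstruction

/-! ### Chains of elementary submodels -/

section HereditarySets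

variable {χ : Cardinal.{u}}

theorem toZFSet_mem_hereditarySets {α : Ordinal.{u}} (hα : α < χ.ord) :
    α.toZFSet ∈ hereditarySets χ :=
  ⟨α.toZFSet, (ZFSet.isOrdinal_toZFSet α).isTransitive, subset_rfl, by
    rw [card_toZFSet]; exact lt_ord.1 hα⟩

theorem aleph_one_le_mk_hereditarySets (hχ : ℵ₁ < χ) : ℵ₁ ≤ #(hereditarySets χ) := by
  have hlt (α : Set.Iio (ω_ 1 : Ordinal.{u})) : α.1 < χ.ord :=
    (Set.mem_Iio.1 α.2).trans (by rwa [← ord_aleph, ord_lt_ord])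
  rw [← mk_Iio_omega_one.{u}]
  exact mk_le_of_injective (f := fun α => ⟨α.1.toZFSet, toZFSet_mem_hereditarySets (hlt α)⟩)
    fun α β h => Subtype.ext (toZFSet_injective (congrArg Subtype.val h))

theorem range_mem_hereditarySets (hχ : χ.IsRegular) {ι : Type u} (hι : #ι < χ)
    {f : ι → ZFSet.{u}} (hf : ∀ i, f i ∈ hereditarySets χ) :
    ZFSet.range f ∈ hereditarySets χ := by
  choose t ht hft hcard using hf
  refine ⟨ZFSet.range f ∪ ZFSet.iUnion t, fun z hz w hw => ?_,
    fun z hz => ZFSet.mem_union.2 (.inl hz), ?_⟩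
  · rw [ZFSet.mem_union, ZFSet.mem_iUnion]
    rcases ZFSet.mem_union.1 hz with hz | hz
    · obtain ⟨i, rfl⟩ := ZFSet.mem_range.1 hz
      exact .inr ⟨i, hft i hw⟩
    · obtain ⟨i, hi⟩ := ZFSet.mem_iUnion.1 hz
      exact .inr ⟨i, (ht i).subset_of_mem hi hw⟩
  · have hrange : (ZFSet.range f).card ≤ #ι := by simpa using ZFSet.lift_card_range_le (f := f)
    have hunion : (ZFSet.iUnion t).card ≤ sum fun i => (t i).card := by
      simpa using ZFSet.lift_card_iUnion_le_sum_card (f := t)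
    exact ZFSet.card_union_le.trans_lt (add_lt_of_lt hχ.aleph0_le (hrange.trans_lt hι)
      (hunion.trans_lt (sum_lt_of_isRegular hχ hι hcard)))

theorem exists_mem_hereditarySets_coe_eq (hχ : χ.IsRegular) {X : Set ZFSet.{u}}
    (hX : X ⊆ hereditarySets χ) (hcard : #X < lift.{u + 1} χ) :
    ∃ y ∈ hereditarySets χ, (y : Set ZFSet.{u}) = X := by
  obtain ⟨κ, hκχ, hκ⟩ := lt_lift_iff.1 hcard
  induction κ using Cardinal.inductionOn with | mk ι
  obtain ⟨e⟩ : Nonempty (ι ≃ X) := lift_mk_eq'.1 (hκ.trans (Cardinal.lift_id'.{u, u + 1} _).symm)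
  refine ⟨ZFSet.range fun i => (e i : ZFSet.{u}),
    range_mem_hereditarySets hχ hκχ fun i => hX (e i).2, ?_⟩
  rw [ZFSet.coe_range]
  exact (e.surjective.range_comp Subtype.val).trans Subtype.range_coe

end HereditarySets

section ElementaryUnion

open FirstOrder FirstOrder.Language

variable {L : FirstOrder.Language.{u, v}} {K : Type w} [L.Structure K]

theorem exists_realize_snoc (N : L.ElementarySubstructure K) {n : ℕ}
    {φ : L.BoundedFormula Empty (n + 1)} {x : Fin n → N} {a : K}
    (h : φ.Realize default (Fin.snoc ((↑) ∘ x) a : _ → K)) :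
    ∃ b : N, φ.Realize default (Fin.snoc ((↑) ∘ x) (b : K) : _ → K) := by
  have hex : φ.ex.Realize (N.subtype ∘ default) (N.subtype ∘ x) := by
    rw [Subsingleton.elim (N.subtype ∘ default) default]
    exact BoundedFormula.realize_ex.2 ⟨a, h⟩
  rw [N.subtype.map_boundedFormula] at hex
  obtain ⟨b, hb⟩ := BoundedFormula.realize_ex.1 hex
  rw [← N.subtype.map_boundedFormula, Fin.comp_snoc,
    Subsingleton.elim (N.subtype ∘ default) default] at hb
  exact ⟨b, hb⟩

theorem exists_elementarySubstructure_coe_eq_iUnion {ι : Type*} [Nonempty ι]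
    {N : ι → L.ElementarySubstructure K} (hN : Directed (· ⊆ ·) fun i => (N i : Set K)) :
    ∃ U : L.ElementarySubstructure K, (U : Set K) = ⋃ i, (N i : Set K) := by
  let U : L.Substructure K := ⨆ i, (N i : L.Substructure K)
  have hmem (a : K) : a ∈ U ↔ ∃ i, a ∈ N i := Substructure.mem_iSup_of_directed hN
  refine ⟨U.toElementarySubstructure fun n φ x a hφ => ?_, ?_⟩
  · choose k hk using fun j => (hmem _).1 (x j).2
    obtain ⟨i, hi⟩ := hN.finite_le k
    obtain ⟨b, hb⟩ := exists_realize_snoc (N i) (x := fun j => ⟨x j, hi j (hk j)⟩) hφ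
    exact ⟨⟨b, (hmem _).2 ⟨i, b.2⟩⟩, hb⟩
  · ext a
    rw [Set.mem_iUnion]
    exact hmem a

end ElementaryUnion

theorem card_setLang_le : setLang.card ≤ ℵ₀ := by
  have : IsEmpty (Σ n, setLang.Functions n) := ⟨fun f => nomatch f.2⟩
  have : Countable (Σ n, setLang.Relations n) :=
    ⟨Sigma.fst, by rintro ⟨_, ⟨⟩⟩ ⟨_, ⟨⟩⟩ _; rfl⟩
  have : Countable setLang.Symbols := inferInstanceAs (Countable (_ ⊕ _))
  exact mk_le_aleph0

namespace IsElementarySubmodel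

variable {χ : Cardinal.{u}}

theorem subset {M : Set ZFSet.{u}} (hM : IsElementarySubmodel χ M) : M ⊆ hereditarySets χ := by
  obtain ⟨N, rfl⟩ := hM
  rintro _ ⟨a, _, rfl⟩
  exact a.2

theorem iUnion {ι : Type*} [Nonempty ι] {M : ι → Set ZFSet.{u}} (hdir : Directed (· ⊆ ·) M)
    (hM : ∀ i, IsElementarySubmodel χ (M i)) : IsElementarySubmodel χ (⋃ i, M i) := by
  choose N hN using hM
  obtain rfl : M = fun i => Subtype.val '' (N i : Set (hereditarySets χ)) := funext hN
  obtain ⟨U, hU⟩ := exists_elementarySubstructure_coe_eq_iUnion (N := N)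
    (hdir.mono_comp _ fun i j => (Set.image_subset_image_iff Subtype.val_injective).1)
  exact ⟨U, by rw [hU, Set.image_iUnion]⟩

theorem exists_superset {κ : Cardinal.{u + 1}} (hκ : ℵ₀ ≤ κ) (hκχ : κ ≤ #(hereditarySets χ))
    {X : Set ZFSet.{u}} (hX : X ⊆ hereditarySets χ) (hcard : #X ≤ κ) :
    ∃ M, IsElementarySubmodel χ M ∧ #M = κ ∧ X ⊆ M := by
  obtain ⟨N, hXN, hN⟩ := FirstOrder.Language.exists_elementarySubstructure_card_eq setLang
    (Subtype.val ⁻¹' X : Set (hereditarySets χ)) κ hκ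
    (by simpa using (mk_preimage_of_injective _ _ Subtype.val_injective).trans hcard)
    (by simpa using (lift_le.{u + 1}.2 card_setLang_le).trans (by simpa using hκ)) (by simpa)
  refine ⟨_, ⟨N, rfl⟩, ?_, fun z hz => ⟨⟨z, hX hz⟩, hXN hz, rfl⟩⟩
  rw [mk_image_eq Subtype.val_injective]
  simpa using hN

end IsElementarySubmodel

theorem exists_countable_cofinal_family {α : Type v} (hα : #α ≤ ℵ₁) :
    ∃ 𝒴 : Set (Set α), #𝒴 ≤ ℵ₁ ∧ (∀ Y ∈ 𝒴, Y.Countable) ∧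
      ∀ Z : Set α, Z.Countable → ∃ Y ∈ 𝒴, Z ⊆ Y := by
  obtain ⟨g⟩ : Nonempty (α ↪ Set.Iio (ω_ 1 : Ordinal.{v})) := lift_mk_le'.1 <| by
    rw [mk_Iio_omega_one]
    simpa using Cardinal.lift_le.{v + 1}.2 hα
  let Y (ξ : Ordinal.{v}) : Set α := {a | (g a : Ordinal.{v}) < ξ}
  refine ⟨Y '' Set.Iio (ω_ 1), ?_, ?_, fun Z hZ => ?_⟩
  · have h := mk_image_le_lift (f := Y) (s := Set.Iio (ω_ 1))
    rw [mk_Iio_omega_one] at h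
    simpa using h
  · rintro _ ⟨ξ, hξ, rfl⟩
    exact (countable_Iio_of_lt_omega_one hξ).preimage (Subtype.val_injective.comp g.injective)
  · obtain ⟨ξ, hξ, hZξ⟩ := exists_forall_lt_of_countable (α := ω_ 1) (by simp)
      (hZ.image fun a => (g a : Ordinal.{v})) (Set.forall_mem_image.2 fun a _ => (g a).2)
    exact ⟨Y ξ, ⟨ξ, hξ, rfl⟩, fun a ha => hZξ _ ⟨a, ha, rfl⟩⟩

/-- Every countably infinite subset of `X` is included in a countable subset of `M` that is an
element of `M`. For `X = M` this says that `[M]^ℵ₀ ∩ M` is cofinal in `[M]^ℵ₀`. -/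
def CoversCountable (M X : Set ZFSet.{u}) : Prop :=
  ∀ Z ⊆ X, #Z = ℵ₀ → ∃ y : ZFSet.{u}, y ∈ M ∧ (y : Set ZFSet.{u}) ⊆ M ∧
    #(y : Set ZFSet.{u}) = ℵ₀ ∧ Z ⊆ (y : Set ZFSet.{u})

theorem CoversCountable.mono {M M' X X' : Set ZFSet.{u}} (h : CoversCountable M X) (hM : M ⊆ M')
    (hX : X' ⊆ X) : CoversCountable M' X' := fun Z hZ hcard => by
  obtain ⟨y, hy, hyM, hy'⟩ := h Z (hZ.trans hX) hcard
  exact ⟨y, hM hy, hyM.trans hM, hy'⟩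

section SubmodelChain

variable {χ : Cardinal.{u}}

theorem exists_isElementarySubmodel_coversCountable (hreg : χ.IsRegular) (hχ : ℵ₁ < χ)
    {X : Set ZFSet.{u}} (hX : X ⊆ hereditarySets χ) (hcard : #X ≤ ℵ₁) :
    ∃ M, IsElementarySubmodel χ M ∧ #M = ℵ₁ ∧ X ⊆ M ∧ CoversCountable M X := by
  obtain ⟨𝒴, h𝒴, hcount, hcof⟩ := exists_countable_cofinal_family hcard
  have hcode (Y : Set X) (hY : Y ∈ 𝒴) :
      ∃ y ∈ hereditarySets χ, (y : Set ZFSet.{u}) = Subtype.val '' Y :=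
    exists_mem_hereditarySets_coe_eq hreg ((Subtype.coe_image_subset X Y).trans hX) <|
      ((hcount Y hY).image _).le_aleph0.trans_lt <|
        aleph0_lt_lift.2 (aleph0_lt_aleph_one.trans hχ)
  choose! code hcodeH hcode using hcode
  obtain ⟨M, hM, hMcard, hXM⟩ := IsElementarySubmodel.exists_superset (aleph0_le_aleph 1)
    (aleph_one_le_mk_hereditarySets hχ) (X := X ∪ code '' 𝒴)
    (Set.union_subset hX (Set.image_subset_iff.2 hcodeH))
    ((mk_union_le _ _).trans (add_le_of_le (aleph0_le_aleph 1) hcard (mk_image_le.trans h𝒴)))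
  rw [Set.union_subset_iff] at hXM
  refine ⟨M, hM, hMcard, hXM.1, fun Z hZX hZ => ?_⟩
  have hZc : Z.Countable := le_aleph0_iff_set_countable.1 hZ.le
  obtain ⟨Y, hY, hZY⟩ := hcof (Subtype.val ⁻¹' Z) (hZc.preimage Subtype.val_injective)
  have hZy : Z ⊆ code Y := by
    rw [hcode Y hY]
    exact fun z hz => ⟨⟨z, hZX hz⟩, hZY hz, rfl⟩
  have hyc : #(code Y : Set ZFSet.{u}) ≤ ℵ₀ := by
    rw [hcode Y hY]
    exact ((hcount Y hY).image _).le_aleph0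
  refine ⟨code Y, hXM.2 ⟨Y, hY, rfl⟩, ?_, hyc.antisymm (hZ ▸ mk_le_mk_of_subset hZy), hZy⟩
  rw [hcode Y hY]
  exact (Subtype.coe_image_subset X Y).trans hXM.1

/-- An increasing chain of elementary submodels of `H_χ` of size `ℵ₁` in which every model covers
the countable subsets of the earlier ones. -/
structure IsSubmodelChain (χ : Cardinal.{u}) (M : Ordinal.{u} → Set ZFSet.{u}) : Prop where
  isElementarySubmodel : ∀ η < ω_ 2, IsElementarySubmodel χ (M η)
  mk_eq : ∀ η < ω_ 2, #(M η) = ℵ₁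
  monotoneOn : MonotoneOn M (Set.Iio (ω_ 2))
  coversCountable : ∀ η < ω_ 2, ∀ ζ < η, CoversCountable (M η) (M ζ)

theorem exists_isSubmodelChain (hreg : χ.IsRegular) (hχ : ℵ₁ < χ)
    {P : Ordinal.{u} → Set ZFSet.{u}} (hP : ∀ η < ω_ 2, P η ⊆ hereditarySets χ)
    (hcard : ∀ η < ω_ 2, #(P η) ≤ ℵ₁) :
    ∃ M, IsSubmodelChain χ M ∧ ∀ η < ω_ 2, P η ⊆ M η := by
  choose! G hGelem hGcard hGsub hGcov using fun X (hX : X ⊆ hereditarySets χ) (h : #X ≤ ℵ₁) =>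
    exists_isElementarySubmodel_coversCountable hreg hχ hX h
  let M : Ordinal.{u} → Set ZFSet.{u} := WellFoundedLT.fix fun η ih =>
    G (P η ∪ ⋃ ζ : Set.Iio η, ih ζ.1 ζ.2)
  let prev (η : Ordinal.{u}) : Set ZFSet.{u} := P η ∪ ⋃ ζ : Set.Iio η, M ζ
  have hM (η : Ordinal.{u}) : M η = G (prev η) := WellFoundedLT.fix_eq _ η
  have hprev (η : Ordinal.{u}) (hη : η < ω_ 2) : prev η ⊆ hereditarySets χ ∧ #(prev η) ≤ ℵ₁ := by
    induction η using WellFoundedLT.induction with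
    | ind η ih =>
      have ih' (ζ : Set.Iio η) := ih ζ ζ.2 (lt_trans ζ.2 hη)
      refine ⟨Set.union_subset (hP η hη) (Set.iUnion_subset fun ζ => ?_),
        (mk_union_le _ _).trans (add_le_of_le (aleph0_le_aleph 1) (hcard η hη)
          (mk_iUnion_le_aleph_one (mk_Iio_le_of_lt_omega_two hη) fun ζ => ?_))⟩
      · exact hM ζ ▸ (hGelem _ (ih' ζ).1 (ih' ζ).2).subset
      · exact hM ζ ▸ (hGcard _ (ih' ζ).1 (ih' ζ).2).le
  have hsub (η : Ordinal.{u}) (hη : η < ω_ 2) : prev η ⊆ M η :=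
    hM η ▸ hGsub _ (hprev η hη).1 (hprev η hη).2
  have hlt {ζ η : Ordinal.{u}} (h : ζ < η) : M ζ ⊆ prev η := fun z hz =>
    .inr (Set.mem_iUnion.2 ⟨⟨ζ, h⟩, hz⟩)
  refine ⟨M, ⟨fun η hη => ?_, fun η hη => ?_, fun ζ _ η hη hζη => ?_, fun η hη ζ hζη => ?_⟩,
    fun η hη => Set.subset_union_left.trans (hsub η hη)⟩
  · exact hM η ▸ hGelem _ (hprev η hη).1 (hprev η hη).2
  · exact hM η ▸ hGcard _ (hprev η hη).1 (hprev η hη).2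
  · rcases hζη.eq_or_lt with rfl | hζη
    · exact le_rfl
    · exact (hlt hζη).trans (hsub η hη)
  · rw [hM η]
    exact (hGcov _ (hprev η hη).1 (hprev η hη).2).mono subset_rfl (hlt hζη)

theorem IsSubmodelChain.iUnion_mem_goodSubmodels {M : Ordinal.{u} → Set ZFSet.{u}}
    (hM : IsSubmodelChain χ M) {ξ : Ordinal.{u}} (hξ : ξ ∈ cofOmegaOne) :
    (⋃ η : Set.Iio ξ, M η) ∈ goodSubmodels χ := by
  have hlim := isSuccLimit_of_mem_cofOmegaOne hξ
  have hlt (η : Set.Iio ξ) : η.1 < ω_ 2 := lt_trans η.2 hξ.1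
  have hmono : Monotone fun η : Set.Iio ξ => M η := fun η ζ h => hM.monotoneOn (hlt η) (hlt ζ) h
  have hsub (η : Set.Iio ξ) : M η ⊆ ⋃ η : Set.Iio ξ, M η :=
    Set.subset_iUnion (fun η : Set.Iio ξ => M η) η
  have : Nonempty (Set.Iio ξ) := ⟨⟨0, hlim.bot_lt⟩⟩
  refine ⟨.iUnion hmono.directed_le fun η => hM.isElementarySubmodel η (hlt η),
    le_antisymm ?_ ?_, fun Z hZ hZcard => ?_⟩
  · exact mk_iUnion_le_aleph_one (mk_Iio_le_of_lt_omega_two hξ.1) fun η => (hM.mk_eq η (hlt η)).le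
  · exact hM.mk_eq 0 (hlim.bot_lt.trans hξ.1) ▸ mk_le_mk_of_subset (hsub ⟨0, hlim.bot_lt⟩)
  · choose! r hr using fun z (hz : z ∈ Z) => Set.mem_iUnion.1 (hZ hz)
    have hZc : Z.Countable := le_aleph0_iff_set_countable.1 hZcard.le
    obtain ⟨γ, hγ, hbound⟩ := exists_forall_lt_of_countable (α := ξ)
      (hξ.2 ▸ aleph0_lt_aleph_one) (hZc.image fun z => (r z : Ordinal.{u}))
      (Set.forall_mem_image.2 fun z _ => (r z).2)
    have hZγ : Z ⊆ M γ := fun z hz =>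
      hmono (a := r z) (b := ⟨γ, hγ⟩) (hbound _ ⟨z, hz, rfl⟩).le (hr z hz)
    exact (hM.coversCountable _ (hlt ⟨_, hlim.succ_lt hγ⟩) γ (Order.lt_succ γ)).mono
      (hsub ⟨_, hlim.succ_lt hγ⟩) hZγ Z subset_rfl hZcard

end SubmodelChain

/-! ### Models that trace out a member of a filtration -/

/-- An `ω₂`-filtration of the set `⋃ α < ω₂, F α`: an increasing chain of subsets of size at most
`ℵ₁`, continuous at limit ordinals. -/
structure IsOmegaTwoFiltration (F : Ordinal.{u} → Set ZFSet.{u}) : Prop where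
  monotoneOn : MonotoneOn F (Set.Iio (ω_ 2))
  mk_le : ∀ α < ω_ 2, #(F α) ≤ ℵ₁
  subset_iUnion : ∀ α < ω_ 2, Order.IsSuccLimit α → F α ⊆ ⋃ β : Set.Iio α, F β

namespace IsOmegaTwoFiltration

variable {F : Ordinal.{u} → Set ZFSet.{u}}

theorem exists_subset_of_mk_le (hF : IsOmegaTwoFiltration F) {T : Set ZFSet.{u}}
    (hT : T ⊆ ⋃ α : Set.Iio (ω_ 2 : Ordinal.{u}), F α) (hcard : #T ≤ ℵ₁) :
    ∃ α : Set.Iio (ω_ 2 : Ordinal.{u}), T ⊆ F α := by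
  have : Nonempty (Set.Iio (ω_ 2 : Ordinal.{u})) := ⟨⟨0, (isSuccLimit_omega 2).bot_lt⟩⟩
  choose! ρ hρ using fun z (hz : z ∈ T) => Set.mem_iUnion.1 (hT hz)
  obtain ⟨α, hα⟩ := exists_forall_lt_of_mk_lt_cof (s := ρ '' T) <|
    (mk_image_le.trans hcard).trans_lt (cof_Iio_omega_two ▸ aleph_one_lt_aleph_two)
  exact ⟨α, fun z hz => hF.monotoneOn (ρ z).2 α.2 (hα _ ⟨z, hz, rfl⟩).le (hρ z hz)⟩

/-- Two continuous chains with the same union agree on a club; here the second one is the trace of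
a chain of submodels that absorbs `F`. -/
theorem exists_mem_goodSubmodels (hF : IsOmegaTwoFiltration F) {χ : Cardinal.{u}}
    (hreg : χ.IsRegular) (hχ : ℵ₁ < χ) (hFχ : ∀ α < ω_ 2, F α ⊆ hereditarySets χ)
    {S : Set Ordinal.{u}} (hS : S ⊆ cofOmegaOne) (hstat : IsStationaryInOmegaTwo S)
    {X : Set ZFSet.{u}} (hX : X ⊆ hereditarySets χ) (hcard : #X ≤ ℵ₁) :
    ∃ M ∈ goodSubmodels χ, X ⊆ M ∧
      ∃ α ∈ S, (⋃ β : Set.Iio (ω_ 2 : Ordinal.{u}), F β) ∩ M = F α := by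
  obtain ⟨M, hM, hsub⟩ := exists_isSubmodelChain hreg hχ (P := fun η => X ∪ F η)
    (fun η hη => Set.union_subset hX (hFχ η hη)) fun η hη =>
      (mk_union_le _ _).trans (add_le_of_le (aleph0_le_aleph 1) hcard (hF.mk_le η hη))
  choose g hg using fun η : Set.Iio (ω_ 2 : Ordinal.{u}) =>
    hF.exists_subset_of_mk_le Set.inter_subset_left
      ((mk_le_mk_of_subset (Set.inter_subset_right (s := ⋃ β : Set.Iio (ω_ 2), F β))).trans
        (hM.mk_eq η η.2).le)
  obtain ⟨α, hα, hgα⟩ := hstat <| isClub_closurePoints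
    (cof_Iio_omega_two ▸ aleph0_lt_aleph_one.trans aleph_one_lt_aleph_two)
    (fun η => cof_Iio_omega_two ▸ (mk_Iio_coe_omega_two_le η).trans_lt aleph_one_lt_aleph_two) g
  have hlim := isSuccLimit_of_mem_cofOmegaOne (hS hα)
  have hsubα (η : Set.Iio α.1) : X ∪ F η ⊆ ⋃ η : Set.Iio α.1, M η :=
    (hsub η (lt_trans η.2 α.2)).trans (Set.subset_iUnion (fun η : Set.Iio α.1 => M η) η)
  refine ⟨_, hM.iUnion_mem_goodSubmodels (hS hα),
    Set.subset_union_left.trans (hsubα ⟨0, hlim.bot_lt⟩), α, hα, ?_⟩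
  refine Set.Subset.antisymm ?_ (Set.subset_inter (Set.subset_iUnion_of_subset α subset_rfl) ?_)
  · rintro z ⟨hzF, hzM⟩
    obtain ⟨⟨η, hη⟩, hzη⟩ := Set.mem_iUnion.1 hzM
    let η' : Set.Iio (ω_ 2 : Ordinal.{u}) := ⟨η, lt_trans (Set.mem_Iio.1 hη) α.2⟩
    exact hF.monotoneOn (g η').2 α.2 (hgα η' hη).le (hg η' ⟨hzF, hzη⟩)
  · exact (hF.subset_iUnion α α.2 hlim).trans
      (Set.iUnion_subset fun η => Set.subset_union_right.trans (hsubα η))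

end IsOmegaTwoFiltration

namespace IsConstruction

variable {S : Set Ordinal.{u}} {δ : Ordinal.{u} → Ordinal.{u} → Ordinal.{u}} {C : ZFSet.{u}}
  [BooleanAlgebra C] {A : Ordinal.{u} → BooleanSubalgebra C} {x : Ordinal.{u} → C}

theorem isOmegaTwoFiltration (h : IsConstruction S δ A x) :
    IsOmegaTwoFiltration fun α => Subtype.val '' (A α : Set C) where
  monotoneOn _ _ _ hβ hαβ := Set.image_mono (h.mono hαβ hβ)
  mk_le _ hα := mk_image_le.trans (h.mk_le hα)
  subset_iUnion α hα hlim := by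
    rintro _ ⟨a, ha, rfl⟩
    obtain ⟨β, hβ, haβ⟩ := (h.mem_iff_of_isSuccLimit hα hlim).1 ha
    exact Set.mem_iUnion.2 ⟨⟨β, hβ⟩, a, haβ, rfl⟩

theorem exists_mem_goodSubmodels (h : IsConstruction S δ A x) {χ : Cardinal.{u}}
    (hreg : χ.IsRegular) (hχ : ℵ₁ < χ) (hC : (C : Set ZFSet.{u}) ⊆ hereditarySets χ)
    {S' : Set Ordinal.{u}} (hS' : S' ⊆ cofOmegaOne) (hstat : IsStationaryInOmegaTwo S')
    {X : Set ZFSet.{u}} (hX : X ⊆ hereditarySets χ) (hcard : #X ≤ ℵ₁) :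
    ∃ M ∈ goodSubmodels χ, X ⊆ M ∧
      ∃ α ∈ S', (A α : Set C) = {a : C | (a : ZFSet.{u}) ∈ M} := by
  obtain ⟨M, hM, hXM, α, hα, htrace⟩ := h.isOmegaTwoFiltration.exists_mem_goodSubmodels hreg hχ
    (fun α _ => (Subtype.coe_image_subset _ _).trans hC) hS' hstat hX hcard
  refine ⟨M, hM, hXM, α, hα, Set.ext fun a => ?_⟩
  obtain ⟨β, hβ, ha⟩ := h.exhaust a
  have haF : (a : ZFSet.{u}) ∈ ⋃ β : Set.Iio (ω_ 2 : Ordinal.{u}), Subtype.val '' (A β : Set C) :=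
    Set.mem_iUnion.2 ⟨⟨β, hβ⟩, a, ha, rfl⟩
  rw [← Subtype.val_injective.mem_set_image (s := (A α : Set C)), ← htrace]
  exact and_iff_right haF

end IsConstruction

namespace SetBooleanAlgebra

/-- A cardinal such that `H_χ` contains the algebra for every larger `χ`. It is at least `ℵ₁` so
that `H_χ` has elementary submodels of size `ℵ₁`. -/
noncomputable def bound (A : SetBooleanAlgebra.{u}) : Cardinal.{u} :=
  max ℵ₁ (ZFSet.vonNeumann A.code.rank).card

variable (A : SetBooleanAlgebra.{u}) {χ : Cardinal.{u}}

theorem code_mem_hereditarySets (hχ : A.bound < χ) : A.code ∈ hereditarySets χ :=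
  ⟨ZFSet.vonNeumann A.code.rank, ZFSet.isTransitive_vonNeumann _, ZFSet.subset_vonNeumann_self _,
    (le_max_right _ _).trans_lt hχ⟩

theorem carrier_subset_hereditarySets (hχ : A.bound < χ) :
    (A.carrier : Set ZFSet.{u}) ⊆ hereditarySets χ := by
  intro a ha
  obtain ⟨t, ht, hsub, hcard⟩ := A.code_mem_hereditarySets hχ
  have hsingleton : ({A.carrier} : ZFSet.{u}) ∈ A.code := ZFSet.mem_pair.2 (.inl rfl)
  have hcarrier : A.carrier ∈ t := ht.subset_of_mem (hsub hsingleton) (ZFSet.mem_singleton.2 rfl)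
  exact ⟨t, ht, ht.subset_of_mem (ht.subset_of_mem hcarrier ha), hcard⟩

end SetBooleanAlgebra

namespace IsLadderAlgebra

variable {A : SetBooleanAlgebra.{u}} {S : Set Ordinal.{u}}
  {δ : Ordinal.{u} → Ordinal.{u} → Ordinal.{u}}

theorem sep (hA : IsLadderAlgebra S δ A.carrier) (hS : S ⊆ cofOmegaOne)
    (hstat : IsStationaryInOmegaTwo (cofOmegaOne \ S)) (hδ : IsLadderSystem δ) : A.SEP := by
  obtain ⟨F, x, h⟩ := hA
  refine ⟨A.bound, fun χ hχ hreg X hX hcard => ?_⟩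
  obtain ⟨M, hM, hXM, α, hα, htrace⟩ := h.exists_mem_goodSubmodels hreg
    ((le_max_left _ _).trans_lt hχ) (A.carrier_subset_hereditarySets hχ) Set.sdiff_subset hstat
    hX hcard.le
  exact ⟨M, hM, hXM, F α, htrace, h.sepEmbedded hS hδ hα.1.1 hα.2⟩

theorem not_idp (hA : IsLadderAlgebra S δ A.carrier) (hS : S ⊆ cofOmegaOne)
    (hstat : IsStationaryInOmegaTwo S) (hδ : IsLadderSystem δ) : ¬ A.IDP := by
  obtain ⟨F, x, h⟩ := hA
  rintro ⟨κ, hκ⟩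
  have hℵ₁ : ℵ₁ ≤ A.bound := le_max_left _ _
  let χ := Order.succ (max κ A.bound)
  have hκχ : κ < χ := Order.lt_succ_of_le (le_max_left _ _)
  have hbound : A.bound < χ := Order.lt_succ_of_le (le_max_right _ _)
  have hreg : χ.IsRegular :=
    isRegular_succ (((aleph0_le_aleph 1).trans hℵ₁).trans (le_max_right _ _))
  obtain ⟨M, hM, hcode, α, hα, htrace⟩ := h.exists_mem_goodSubmodels hreg (hℵ₁.trans_lt hbound)
    (A.carrier_subset_hereditarySets hbound) hS hstat (X := {A.code})
    (Set.singleton_subset_iff.2 (A.code_mem_hereditarySets hbound))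
    (by rw [mk_singleton]; exact one_lt_aleph0.le.trans (aleph0_le_aleph 1))
  obtain ⟨N, hN, hsigma⟩ := hκ χ hκχ hreg M hM (hcode rfl)
  obtain rfl : N = F α := SetLike.coe_injective (hN.trans htrace.symm)
  exact h.not_sigmaEmbedded hS hδ hα hsigma

end IsLadderAlgebra

theorem IsStationaryPartition.right_subset {S₀ S₁ : Set Ordinal.{u}}
    (h : IsStationaryPartition S₀ S₁) : S₁ ⊆ cofOmegaOne :=
  h.union_eq ▸ Set.subset_union_right

theorem IsStationaryPartition.diff_right_eq {S₀ S₁ : Set Ordinal.{u}}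
    (h : IsStationaryPartition S₀ S₁) : cofOmegaOne \ S₁ = S₀ := by
  rw [← h.union_eq, Set.union_sdiff_right, h.disjoint.sdiff_eq_left]

theorem theorem6p4 :
    (∃ A : SetBooleanAlgebra.{u}, A.SEP ∧ ¬ A.IDP) ∧
    (∃ S₀ S₁ : Set Ordinal.{u}, IsStationaryPartition S₀ S₁) ∧
    (∃ δ : Ordinal.{u} → Ordinal.{u} → Ordinal.{u}, IsLadderSystem δ) ∧
    ∀ (S₀ S₁ : Set Ordinal.{u}) (δ : Ordinal.{u} → Ordinal.{u} → Ordinal.{u}),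
      IsStationaryPartition S₀ S₁ → IsLadderSystem δ →
        (∃ A : SetBooleanAlgebra.{u}, IsLadderAlgebra S₁ δ A.carrier) ∧
        ∀ A : SetBooleanAlgebra.{u}, IsLadderAlgebra S₁ δ A.carrier → A.SEP ∧ ¬ A.IDP := by
  have hexists {S₀ S₁ : Set Ordinal.{u}} {δ} (hS : IsStationaryPartition S₀ S₁)
      (hδ : IsLadderSystem δ) : ∃ A : SetBooleanAlgebra.{u}, IsLadderAlgebra S₁ δ A.carrier :=
    exists_isLadderAlgebra hS.right_subset hδ
  have hsep {S₀ S₁ : Set Ordinal.{u}} {δ} (hS : IsStationaryPartition S₀ S₁)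
      (hδ : IsLadderSystem δ) (A : SetBooleanAlgebra.{u}) (hA : IsLadderAlgebra S₁ δ A.carrier) :
      A.SEP ∧ ¬ A.IDP :=
    ⟨hA.sep hS.right_subset (hS.diff_right_eq ▸ hS.stationary_left) hδ,
      hA.not_idp hS.right_subset hS.stationary_right hδ⟩
  obtain ⟨S₀, S₁, hS⟩ := exists_isStationaryPartition.{u}
  obtain ⟨δ, hδ⟩ := exists_isLadderSystem.{u}
  obtain ⟨A, hA⟩ := hexists hS hδ
  exact ⟨⟨A, hsep hS hδ A hA⟩, ⟨S₀, S₁, hS⟩, ⟨δ, hδ⟩,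
    fun _ _ _ hS hδ => ⟨hexists hS hδ, hsep hS hδ⟩⟩
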